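/- **Lemma (distributed ordered tree decomposition of biconnected planar networks).** *Model.* A network is a finite simple graph $G=(V,E)$ on $n$ nodes with identifiers $1,\dots,n$. Each node $v$ has local ports $1,\dots,\deg(v)$, one per incident link. Initially $v$ knows only its identifier, its ports, a number $k$, and a cyclic ordering of its ports; the cyclic orderings form a combinatorial embedding of $G$ in the plane (if a face boundary arrives at $v$ along $(u,v)$, it continues along the arc $(v,w)$ that is immediately before $(v,u)$ in the cyclic ordering at $v$, and with $F$ the set of the resulting faces $n-|E|+|F|=2$). $G$ is biconnected if $n\ge 3$, $G$ is connected, and $G-v$ is connected for every $v\in V$. The system is asynchronous and without failures: one node, the requesting node, starts the computation; every other action of a node is the reaction to a received message and consists of a change of the local state and the sending of messages over ports. Messages may be delivered in any order and with any delay. TIME is measured with every message delay at most one time unit and with instantaneous local computation; MSG/LINK is the maximal number of messages sent over a link, in both directions together. *Ordered tree decomposition.* An ordered tree decomposition of $G$ of width $w$ is a rooted tree together with a $(w+1)$-tuple of vertices of $G$ (repetitions allowed), called a bag, for each tree vertex, such that both ends of every edge of $G$ lie in a common bag and, for every $v\in V$, the tree vertices whose bags contain $v$ form a non-empty connected subtree.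 *Statement.* There is a distributed algorithm, the same for all networks and all $k$, and for every $k$ a constant $C_k$ such that for every biconnected planar network $G$ with a stored combinatorial embedding and with diameter at most $k$ ($k$ being known to each node), every requesting node $r$, and every execution of the algorithm: 1. the execution is finite, and it ends within time $C_k\cdot n$, i.e. $\mathrm{TIME}=O(n)$; 2. at most $C_k$ messages are sent over each link, i.e. $\mathrm{MSG/LINK}=O(1)$, and every message has at most $C_k\lfloor\log_2 n\rfloor$ bits; 3. when it ends (no message is in transit), the nodes store an ordered tree decomposition of $G$ of width $3k$: each node holds a list of bags, given by identifiers; the tree vertices are the stored bags; the root bag is stored in $r$; and for every other bag, stored in a node $v$, the father bag is stored in a neighbor of $v$, and $v$ stores the port to that neighbor and the number of the father bag in the neighbor's list. -/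

import Mathlib

/-! ### Graphs and ordered tree decompositions -/

/-- A biconnected graph: at least three vertices, connected, and still connected after the removal
of any single vertex. -/
def SimpleGraph.IsBiconnected {V : Type} (G : SimpleGraph V) : Prop :=
  3 ≤ Nat.card V ∧ G.Connected ∧ ∀ v : V, (G.induce {v}ᶜ).Connected

/-- A rooted tree on the vertex set `T`, given by its child-to-parent relation: only the root has no
father, and every vertex reaches the root by passing to fathers. -/
structure RootedTreeOn (T : Type) where
  root : T
  father : T → Option T
  father_root : father root = none
  reaches_root : ∀ t, Relation.ReflTransGen (fun s u => father s = some u) t root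

/-- The undirected tree underlying a rooted tree. -/
def RootedTreeOn.graph {T : Type} (F : RootedTreeOn T) : SimpleGraph T :=
  SimpleGraph.fromRel fun s u => F.father s = some u

/-- `(F, B)` is a tree decomposition of `G`: every edge lies in a bag, and the tree vertices whose
bags contain a given vertex are connected in the tree (in particular there is one). -/
structure IsTreeDecomposition {V T : Type} (G : SimpleGraph V) (F : RootedTreeOn T)
    (B : T → Set V) : Prop where
  edge_mem : ∀ v w, G.Adj v w → ∃ t, v ∈ B t ∧ w ∈ B t
  connected : ∀ v, (F.graph.induce {t | v ∈ B t}).Connected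

/-- `(F, L)` is an ordered tree decomposition of width `w` of `G`: the bags are `(w + 1)`-tuples,
possibly with repetitions, whose entries form a tree decomposition. -/
def IsOrderedTreeDecomposition {V T : Type} (G : SimpleGraph V) (F : RootedTreeOn T) {w : ℕ}
    (L : T → Fin (w + 1) → V) : Prop :=
  IsTreeDecomposition G F fun t => Set.range (L t)

/-! ### Networks with a stored combinatorial embedding -/

/-- A network on `n` nodes. Every node has local ports, one for each incident link, and stores a
cyclic ordering of its ports: `rot v p` is the port that comes immediately after `p` at `v`. -/
structure Network (n : ℕ) where
  graph : SimpleGraph (Fin n)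
  deg : Fin n → ℕ
  port : ∀ v, Fin (deg v) ≃ graph.neighborSet v
  rot : ∀ v, Equiv.Perm (Fin (deg v))
  rot_cyclic : ∀ v, (rot v).IsCycleOn Set.univ

namespace Network

variable {n : ℕ} (N : Network n)

/-- The arcs of the network: `⟨v, p⟩` is the link at port `p` of `v`, directed away from `v`. Each
link gives two arcs of opposite directions. -/
abbrev Arc : Type := Σ v : Fin n, Fin (N.deg v)

/-- The neighbor of `v` at port `p`. -/
def neighbor (v : Fin n) (p : Fin (N.deg v)) : Fin n := (N.port v p : Fin n)

theorem adj_neighbor (v : Fin n) (p : Fin (N.deg v)) : N.graph.Adj v (N.neighbor v p) :=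
  (N.port v p).2

/-- The same link directed the other way: `(N.rev a).1` is the node to which `a` leads, and
`(N.rev a).2` is the port of that node for the link. -/
def rev (a : N.Arc) : N.Arc :=
  ⟨N.neighbor a.1 a.2, (N.port (N.neighbor a.1 a.2)).symm ⟨a.1, (N.adj_neighbor a.1 a.2).symm⟩⟩

theorem arc_ext {a b : N.Arc} (h₁ : a.1 = b.1) (h₂ : N.neighbor a.1 a.2 = N.neighbor b.1 b.2) :
    a = b := by
  obtain ⟨v, p⟩ := a
  obtain ⟨w, q⟩ := b
  cases h₁
  have h : p = q := (N.port v).injective (Subtype.ext h₂)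
  rw [h]

theorem neighbor_rev (a : N.Arc) : N.neighbor (N.rev a).1 (N.rev a).2 = a.1 :=
  congrArg Subtype.val ((N.port (N.neighbor a.1 a.2)).apply_symm_apply
    ⟨a.1, (N.adj_neighbor a.1 a.2).symm⟩)

theorem rev_rev (a : N.Arc) : N.rev (N.rev a) = a :=
  N.arc_ext (N.neighbor_rev a) (N.neighbor_rev (N.rev a))

/-- The face permutation: a face boundary that arrives at `v` by the arc `(u, v)` leaves `v` by the
arc that comes immediately before `(v, u)` in the cyclic ordering at `v`. -/
def facePerm : Equiv.Perm N.Arc :=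
  (Function.Involutive.toPerm N.rev N.rev_rev).trans
    (Equiv.sigmaCongrRight fun v => (N.rot v).symm)

/-- The number of faces, i.e. of orbits of the face permutation. -/
noncomputable def faceCount : ℕ := Nat.card (Quotient (Equiv.Perm.SameCycle.setoid N.facePerm))

/-- The cyclic orderings form a combinatorial embedding of the (connected) graph into the plane:
Euler's formula `n - |E| + |F| = 2` holds for the faces that they determine. -/
def IsPlanarEmbedding : Prop := n + N.faceCount = N.graph.edgeSet.ncard + 2

end Network

/-! ### Asynchronous message passing -/

/-- Messages are bit strings. -/
abbrev Message : Type := List Bool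

/-- What a node initially knows: the bound `k` on the diameter, its own identifier, the number of
its ports, and the cyclic ordering of its ports. -/
structure LocalInput where
  k : ℕ
  ident : ℕ
  deg : ℕ
  rot : Equiv.Perm (Fin deg)

/-- A distributed algorithm: one and the same local program for all nodes of all networks. The
requesting node runs `start` once. After that a node acts only on the reception of a message: from
its state, the port of arrival and the message it computes a new state and the messages to be sent
over its ports. The result computed by a node is read off from its state by `output`. -/
structure DistAlgorithm (Out : LocalInput → Type) where
  State : Type
  initState : LocalInput → State
  start : (inp : LocalInput) → State → State × List (Fin inp.deg × Message)
  receive : (inp : LocalInput) → State → Fin inp.deg → Message →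
    State × List (Fin inp.deg × Message)
  output : (inp : LocalInput) → State → Out inp

/-- The initial knowledge of the node `v`; the identifiers are `1, …, n`. -/
def Network.localInput {n : ℕ} (N : Network n) (k : ℕ) (v : Fin n) : LocalInput :=
  ⟨k, (v : ℕ) + 1, N.deg v, N.rot v⟩

/-- A message sent along the arc `arc` at time `time`. -/
structure Packet {n : ℕ} (N : Network n) where
  arc : N.Arc
  body : Message
  time : ℝ

/-- A configuration: the states of the nodes, the messages in transit, all the messages sent since
the beginning, and the current time. -/
structure Config {Out : LocalInput → Type} (A : DistAlgorithm Out) {n : ℕ} (N : Network n) where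
  state : Fin n → A.State
  transit : Multiset (Packet N)
  sent : Multiset (Packet N)
  clock : ℝ

namespace Config

variable {Out : LocalInput → Type} {A : DistAlgorithm Out} {n : ℕ} {N : Network n}

/-- At time `t` the node `v` goes into the state `r.1` and sends the messages `r.2`. -/
def act (c : Config A N) (v : Fin n) (t : ℝ) (r : A.State × List (Fin (N.deg v) × Message)) :
    Config A N where
  state := Function.update c.state v r.1
  transit := c.transit + (r.2.map fun x => (⟨⟨v, x.1⟩, x.2, t⟩ : Packet N) : List (Packet N))
  sent := c.sent + (r.2.map fun x => (⟨⟨v, x.1⟩, x.2, t⟩ : Packet N) : List (Packet N))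
  clock := t

/-- The configuration at time `0`, in which the requesting node `r` has just started. -/
def initial (A : DistAlgorithm Out) (N : Network n) (k : ℕ) (r : Fin n) : Config A N :=
  Config.act ⟨fun v => A.initState (N.localInput k v), 0, 0, 0⟩ r 0
    (A.start (N.localInput k r) (A.initState (N.localInput k r)))

/-- One step of an asynchronous execution: at some time `t`, an arbitrary message in transit is
delivered and handled by its receiver. Delays are arbitrary, but at most one unit of time; local
computation takes no time; messages, even over the same link, may overtake each other. -/
def Step (k : ℕ) (c c' : Config A N) : Prop :=
  ∃ (p : Packet N) (rest : Multiset (Packet N)) (t : ℝ),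
    c.transit = p ::ₘ rest ∧ c.clock ≤ t ∧ (∀ q ∈ c.transit, t ≤ q.time + 1) ∧
    c' = Config.act { c with transit := rest } (N.rev p.arc).1 t
      (A.receive (N.localInput k (N.rev p.arc).1) (c.state (N.rev p.arc).1) (N.rev p.arc).2 p.body)

/-- The configurations that can occur in an execution started by the requesting node `r`. -/
def Reachable (k : ℕ) (r : Fin n) (c : Config A N) : Prop :=
  Relation.ReflTransGen (Step k) (initial A N k r) c

/-- The number of messages sent so far over the link of the arc `a`, in both directions. -/
def linkCount (c : Config A N) (a : N.Arc) : ℕ :=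
  c.sent.countP fun p => p.arc = a ∨ p.arc = N.rev a

end Config

/-! ### Distributed storage of a decomposition -/

/-- A bag stored in a node with `d` ports: the identifiers of the `w + 1` entries of the bag and,
unless the bag is the root, a reference `(p, j)` to its father, which is the bag number `j` among
those stored in the neighbor at port `p`. -/
structure StoredBag (w d : ℕ) where
  label : Fin (w + 1) → ℕ
  father : Option (Fin d × ℕ)

/-- The result that a node computes: the list of the bags stored in it, `(3k + 1)`-tuples each. -/
abbrev BagList (inp : LocalInput) : Type := List (StoredBag (3 * inp.k) inp.deg)

/-- The lists `out` store an ordered tree decomposition of width `3k` of the network: its vertices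
are the stored bags, its root is stored in the node `r`, and every other bag has its father stored
in a neighbor of the node that stores the bag. -/
def StoresDecomposition {n : ℕ} (N : Network n) (k : ℕ) (r : Fin n)
    (out : ∀ v : Fin n, List (StoredBag (3 * k) (N.deg v))) : Prop :=
  ∃ (F : RootedTreeOn (Σ v : Fin n, Fin (out v).length))
    (L : (Σ v : Fin n, Fin (out v).length) → Fin (3 * k + 1) → Fin n),
    IsOrderedTreeDecomposition N.graph F L ∧ F.root.1 = r ∧
    ∀ b : (Σ v : Fin n, Fin (out v).length),
      (∀ i, ((out b.1).get b.2).label i = (L b i : ℕ) + 1) ∧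
      (F.father b = none → ((out b.1).get b.2).father = none) ∧
      ∀ b', F.father b = some b' →
        ∃ p : Fin (N.deg b.1), ((out b.1).get b.2).father = some (p, (b'.2 : ℕ)) ∧
          N.neighbor b.1 p = b'.1

/-! Let T be a spanning tree of depth at most k with root r. The walk around T traverses the tree
links and turns past all others; it lists all arcs in one cycle, starting with an arc a₀ at r
(`RootedSubtree.sameCycle_contour`). Call an arc outside T closing if its reverse comes earlier in
this walk; each link outside T has exactly one closing arc. The boundary of every face contains a
closing arc or a₀ (`exists_exit`), and by Euler's formula there is exactly one face more than there
are closing arcs. So every face has exactly one such exit (`exit_unique`); the head of the exit is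
called the apex of the face.

The decomposition has one bag per arc a: the vertices on the tree paths to r from the two ends of a
and from the apex of its face. The father of a closing arc is its reverse; the father of any other
arc except a₀ is the next arc of the face. Thus each face boundary is cut open at its exit and glued
there to the face on the other side. For a vertex x, the bags containing x are connected
(`eqvGen_of_mem_bag`): if x is above the apex of a face, the whole boundary hangs together, and the
arcs with tail below x are linked by the walk around the part of T below x. For x = r, which is in
every bag, the same fact shows that the father relation is a tree rooted at a₀. Three paths of at
most k + 1 vertices share r, so 3k + 1 entries suffice.

A single token computes this in rounds 0, …, k. In round j it walks around the tree up to level j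
and probes the other links; nodes discovered by a probe get level j + 1. In round k the tree spans,
and the token carries the tree path of the apex of the current face. If it crosses a link outside T
for the first time, the reverse arc is the exit of the face that it enters, so the apex is the node
where it stands. At the second crossing it returns to the face from which the link was first probed,
and that probe left the path of the apex at this node (`InLastRound.carry_after_probe`).

There is always at most one message in transit, so an execution is a sequence of numbered stages,
each costing at most one unit of time (`Tracked.step`). A round has at most one step per arc, there
are at most 6n arcs (`card_arc_le`), and a round meets each link at most twice, with at most two
messages each time. -/

/-- If an equivalence relation relates every element of a cycle of `σ`, except possibly `a`, to its
image, then all elements of the cycle are equivalent. -/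
theorem Equiv.Perm.SameCycle.rel_of_forall_ne {α : Type*} [Finite α] {σ : Equiv.Perm α}
    {R : α → α → Prop} (hR : Equivalence R) {a b c : α}
    (h : ∀ x, σ.SameCycle a x → x ≠ a → R x (σ x)) (hb : σ.SameCycle a b)
    (hc : σ.SameCycle a c) : R b c := by
  have key : ∀ x, σ.SameCycle a x → R (σ a) x := by
    intro x hx
    have hx' : σ.SameCycle (σ a) x := hx.apply_left
    obtain ⟨i, -, -, rfl⟩ := hx'.exists_pow_eq''
    clear hx hx'
    induction i with
    | zero => exact hR.refl _
    | succ i ih =>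
      rw [pow_succ', Equiv.Perm.mul_apply]
      by_cases hi : (σ ^ i) (σ a) = a
      · rw [hi]
        exact hR.refl _
      · exact hR.trans ih (h _ (by simp [Equiv.Perm.SameCycle.refl]) hi)
  exact hR.trans (hR.symm (key b hb)) (key c hc)

/-! ### Arcs, rooted subtrees and the walk around a subtree -/

namespace Network

variable {n : ℕ} (N : Network n)

theorem rev_fst (a : N.Arc) : (N.rev a).1 = N.neighbor a.1 a.2 := rfl

theorem adj_rev (a : N.Arc) : N.graph.Adj a.1 (N.rev a).1 := N.adj_neighbor a.1 a.2

theorem rev_fst_ne (a : N.Arc) : (N.rev a).1 ≠ a.1 := (N.adj_rev a).ne'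

theorem rev_ne (a : N.Arc) : N.rev a ≠ a := fun h => N.rev_fst_ne a (congrArg Sigma.fst h)

theorem rev_injective : Function.Injective N.rev := fun a b h => by
  rw [← N.rev_rev a, h, N.rev_rev]

theorem rev_eq_iff {a b : N.Arc} : N.rev a = b ↔ a = N.rev b :=
  ⟨fun h => by rw [← h, N.rev_rev], fun h => by rw [h, N.rev_rev]⟩

theorem exists_arc {v w : Fin n} (h : N.graph.Adj v w) : ∃ a : N.Arc, a.1 = v ∧ (N.rev a).1 = w := by
  refine ⟨⟨v, (N.port v).symm ⟨w, h⟩⟩, rfl, ?_⟩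
  simp [rev_fst, neighbor]

/-- The permutation that sends each arc to the preceding arc at the same tail. -/
def turn : Equiv.Perm N.Arc := Equiv.sigmaCongrRight fun v => (N.rot v).symm

theorem turn_fst (a : N.Arc) : (N.turn a).1 = a.1 := rfl

theorem facePerm_apply (a : N.Arc) : N.facePerm a = N.turn (N.rev a) := rfl

theorem turn_pow_mk (v : Fin n) (p : Fin (N.deg v)) (i : ℕ) :
    (N.turn ^ i) ⟨v, p⟩ = ⟨v, ((N.rot v).symm ^ i) p⟩ := by
  induction i with
  | zero => rfl
  | succ i ih => rw [pow_succ', pow_succ', Equiv.Perm.mul_apply, ih]; rfl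

theorem sameCycle_turn {a b : N.Arc} (h : a.1 = b.1) : N.turn.SameCycle a b := by
  obtain ⟨v, p⟩ := a
  obtain ⟨w, q⟩ := b
  cases h
  have hc : Equiv.Perm.SameCycle (N.rot v).symm p q :=
    Equiv.Perm.sameCycle_inv.2 ((N.rot_cyclic v).2 (Set.mem_univ p) (Set.mem_univ q))
  obtain ⟨i, -, -, hi⟩ := hc.exists_pow_eq''
  exact ⟨i, by rw [zpow_natCast, turn_pow_mk, hi]⟩

theorem fst_eq_of_sameCycle_turn {a b : N.Arc} (h : N.turn.SameCycle a b) : b.1 = a.1 := by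
  obtain ⟨i, -, -, rfl⟩ := h.exists_pow_eq''
  rw [turn_pow_mk]

/-- A tree in the network, with root `r`, given by the set of its arcs from children to fathers. -/
structure RootedSubtree (r : Fin n) where
  up : Set N.Arc
  level : Fin n → ℕ
  up_inj : ∀ a ∈ up, ∀ b ∈ up, a.1 = b.1 → a = b
  level_lt : ∀ a ∈ up, level (N.rev a).1 < level a.1
  ne_root : ∀ a ∈ up, a.1 ≠ r
  head_mem : ∀ a ∈ up, (N.rev a).1 = r ∨ ∃ b ∈ up, b.1 = (N.rev a).1

namespace RootedSubtree

variable {N} {r : Fin n} (T : N.RootedSubtree r)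

/-- The arcs of the tree, in both directions. -/
def arcs : Set N.Arc := {a | a ∈ T.up ∨ N.rev a ∈ T.up}

theorem rev_mem_arcs (a : N.Arc) : N.rev a ∈ T.arcs ↔ a ∈ T.arcs := by
  simp only [arcs, Set.mem_ofPred_eq, N.rev_rev]
  exact or_comm

/-- The nodes of the tree. -/
def nodes : Set (Fin n) := {v | v = r ∨ ∃ a ∈ T.up, a.1 = v}

/-- `T.Below x w`: the node `x` lies on the path of the tree from `w` to the root. -/
def Below (x w : Fin n) : Prop :=
  Relation.ReflTransGen (fun w u => ∃ a ∈ T.up, a.1 = w ∧ (N.rev a).1 = u) w x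

theorem Below.of_up {x : Fin n} {a : N.Arc} (ha : a ∈ T.up) (h : T.Below x (N.rev a).1) :
    T.Below x a.1 :=
  Relation.ReflTransGen.head ⟨a, ha, rfl, rfl⟩ h

theorem below_iff {x w : Fin n} :
    T.Below x w ↔ w = x ∨ ∃ a ∈ T.up, a.1 = w ∧ T.Below x (N.rev a).1 := by
  constructor
  · intro h
    rcases Relation.ReflTransGen.cases_head h with h | ⟨u, ⟨a, ha, h1, rfl⟩, h⟩
    · exact Or.inl h
    · exact Or.inr ⟨a, ha, h1, h⟩
  · rintro (rfl | ⟨a, ha, rfl, h⟩)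
    · exact Relation.ReflTransGen.refl
    · exact Below.of_up T ha h

theorem below_root_of_mem_nodes {w : Fin n} (hw : w ∈ T.nodes) : T.Below r w := by
  induction h : T.level w using Nat.strong_induction_on generalizing w with
  | _ l ih =>
    subst h
    rcases hw with rfl | ⟨a, ha, rfl⟩
    · exact Relation.ReflTransGen.refl
    · exact Below.of_up T ha (ih _ (T.level_lt a ha) (T.head_mem a ha) rfl)

section Contour

variable {R : N.Arc → N.Arc → Prop} (hR : Equivalence R) {x : Fin n}
  (chord : ∀ b, b ∉ T.arcs → T.Below x b.1 → R b (N.turn b))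
  (tree : ∀ b, b ∈ T.arcs → T.Below x (N.rev b).1 → R b (N.turn (N.rev b)))
include hR chord tree

theorem rel_turn_of_child {b : N.Arc} (hb : T.Below x b.1) (hup : b ∉ T.up)
    (child : N.rev b ∈ T.up → R b (N.rev b)) : R b (N.turn b) := by
  by_cases ht : b ∈ T.arcs
  · have hr : N.rev b ∈ T.up := ht.resolve_left hup
    have h := tree (N.rev b) ((T.rev_mem_arcs b).2 ht) (by rwa [N.rev_rev])
    rw [N.rev_rev] at h
    exact hR.trans (child hr) h
  · exact chord b ht hb

/-- An excursion into a subtree comes back: the walk arrives at a node along `N.rev a`, turns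
through all its other arcs and leaves by `a`. The induction runs from the deepest levels upwards, so
that each child arc met on the way is already related to its reverse. -/
theorem rel_rev_of_up {a : N.Arc} (ha : a ∈ T.up) (hx : T.Below x a.1) : R (N.rev a) a := by
  obtain ⟨K, hK⟩ : ∃ K, ∀ v, T.level v ≤ K :=
    ⟨Finset.univ.sup T.level, fun v => Finset.le_sup (Finset.mem_univ v)⟩
  induction h : K - T.level a.1 using Nat.strong_induction_on generalizing a with
  | _ m ih =>
    subst h
    have h1 : R (N.rev a) (N.turn a) := by
      have h := tree (N.rev a) (Or.inr (by rwa [N.rev_rev])) (by rwa [N.rev_rev])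
      rwa [N.rev_rev] at h
    refine hR.trans h1 ?_
    refine Equiv.Perm.SameCycle.rel_of_forall_ne (σ := N.turn) (a := a) hR ?_
      (Equiv.Perm.SameCycle.refl _ _).apply_right (Equiv.Perm.SameCycle.refl _ _)
    intro b hb hne
    have hfst : b.1 = a.1 := N.fst_eq_of_sameCycle_turn hb
    have hbx : T.Below x b.1 := hfst ▸ hx
    have hup : b ∉ T.up := fun h => hne (T.up_inj b h a ha hfst)
    refine T.rel_turn_of_child hR chord tree hbx hup fun hr => ?_
    have hlt := T.level_lt _ hr
    rw [N.rev_rev, hfst] at hlt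
    have h := ih (K - T.level (N.rev b).1) (by have := hK (N.rev b).1; omega) hr
      (Below.of_up T hr (by rwa [N.rev_rev])) rfl
    rwa [N.rev_rev] at h

/-- The step at the arc to the father may leave the part below `x`, so it is not available. A cycle
with one missing link is still connected; the missing link is placed at the arc to the father, or
anywhere if there is none. -/
theorem rel_of_fst_eq {a b : N.Arc} (ha : T.Below x a.1) (hab : a.1 = b.1) : R a b := by
  obtain ⟨e, hea, he⟩ : ∃ e : N.Arc, e.1 = a.1 ∧ ∀ d ∈ T.up, d.1 = a.1 → d = e := by
    by_cases h : ∃ e ∈ T.up, e.1 = a.1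
    · obtain ⟨e, he, hea⟩ := h
      exact ⟨e, hea, fun d hd hda => T.up_inj d hd e he (hda.trans hea.symm)⟩
    · exact ⟨a, rfl, fun d hd hda => absurd ⟨d, hd, hda⟩ h⟩
  refine Equiv.Perm.SameCycle.rel_of_forall_ne (σ := N.turn) (a := e) hR ?_
    (N.sameCycle_turn hea) (N.sameCycle_turn (hea.trans hab))
  intro d hd hne
  have hfst : d.1 = a.1 := (N.fst_eq_of_sameCycle_turn hd).trans hea
  have hdx : T.Below x d.1 := hfst ▸ ha
  refine T.rel_turn_of_child hR chord tree hdx (fun h => hne (he d h hfst)) fun hr => ?_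
  have h := T.rel_rev_of_up hR chord tree hr (Below.of_up T hr (by rwa [N.rev_rev]))
  rwa [N.rev_rev] at h

/-- An equivalence relation that contains the steps of the walk around the part of the tree below
`x` relates all the arcs whose tails are in this part. -/
theorem rel_of_below {a b : N.Arc} (ha : T.Below x a.1) (hb : T.Below x b.1) : R a b := by
  have key : ∀ c : N.Arc, T.Below x c.1 → ∀ d : N.Arc, d.1 = x → R c d := by
    intro c hc
    induction h : T.level c.1 using Nat.strong_induction_on generalizing c with
    | _ l ih =>
      subst h
      intro d hd
      rcases T.below_iff.1 hc with h | ⟨e, he, hec, hex⟩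
      · exact T.rel_of_fst_eq hR chord tree hc (h.trans hd.symm)
      · refine hR.trans (T.rel_of_fst_eq hR chord tree hc hec.symm) ?_
        refine hR.trans (hR.symm (T.rel_rev_of_up hR chord tree he (hec ▸ hc))) ?_
        exact ih _ (hec ▸ T.level_lt e he) _ hex rfl d hd
  by_cases hd : ∃ d : N.Arc, d.1 = x
  · obtain ⟨d, hd⟩ := hd
    exact hR.trans (key a ha d hd) (hR.symm (key b hb d hd))
  · have hax : ∀ c : N.Arc, T.Below x c.1 → c.1 = x := by
      intro c hc
      by_contra hne
      rcases Relation.ReflTransGen.cases_tail hc with h | ⟨u, -, e, -, -, hex⟩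
      · exact hne h.symm
      · exact hd ⟨N.rev e, hex⟩
    exact absurd ⟨a, hax a ha⟩ hd

end Contour

end RootedSubtree

/-- The walk around a set of arcs: arcs of the set are traversed, other arcs are passed. -/
noncomputable def contour (t : Set N.Arc) (ht : ∀ a, N.rev a ∈ t ↔ a ∈ t) : Equiv.Perm N.Arc :=
  open Classical in
  (Function.Involutive.toPerm (fun a => if a ∈ t then N.rev a else a) fun a => by
    by_cases h : a ∈ t
    · simp [h, ht, N.rev_rev]
    · simp [h]).trans N.turn

variable {N} {t : Set N.Arc} {ht : ∀ a, N.rev a ∈ t ↔ a ∈ t} {a : N.Arc}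

theorem contour_of_mem (h : a ∈ t) : N.contour t ht a = N.turn (N.rev a) := by
  exact congrArg N.turn (if_pos h)

theorem contour_of_notMem (h : a ∉ t) : N.contour t ht a = N.turn a := by
  exact congrArg N.turn (if_neg h)

/-- Being on the same cycle of the walk is an equivalence that contains all its steps, so the
contour argument applies with `x` equal to the root. -/
theorem RootedSubtree.sameCycle_contour {r : Fin n} (T : N.RootedSubtree r) {a b : N.Arc}
    (ha : a.1 ∈ T.nodes) (hb : b.1 ∈ T.nodes) :
    (N.contour T.arcs T.rev_mem_arcs).SameCycle a b := by
  refine T.rel_of_below (x := r) (Equiv.Perm.SameCycle.equivalence _) ?_ ?_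
    (T.below_root_of_mem_nodes ha) (T.below_root_of_mem_nodes hb)
  · intro b hb _
    rw [← contour_of_notMem (ht := T.rev_mem_arcs) hb]
    exact (Equiv.Perm.SameCycle.refl _ _).apply_right
  · intro b hb _
    rw [← contour_of_mem (ht := T.rev_mem_arcs) hb]
    exact (Equiv.Perm.SameCycle.refl _ _).apply_right

end Network

/-! ### Positions on a cycle -/

namespace Equiv.Perm

/-- The number of applications of `σ` that lead from `a` to `b`, if `b` is in the cycle of `a`. -/
noncomputable def stepsTo {α : Type*} (σ : Equiv.Perm α) (a b : α) : ℕ := sInf {i | (σ ^ i) a = b}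

variable {α : Type*} {σ : Equiv.Perm α} {a b : α}

theorem stepsTo_le {i : ℕ} (h : (σ ^ i) a = b) : σ.stepsTo a b ≤ i := Nat.sInf_le h

theorem stepsTo_self : σ.stepsTo a a = 0 := Nat.le_zero.1 (stepsTo_le rfl)

variable [Finite α]

theorem SameCycle.pow_stepsTo (h : σ.SameCycle a b) : (σ ^ σ.stepsTo a b) a = b := by
  obtain ⟨i, -, -, hi⟩ := h.exists_pow_eq''
  exact Nat.sInf_mem (s := {i | (σ ^ i) a = b}) ⟨i, hi⟩

/-- The hypothesis on `σ b` excludes the closing step of the cycle, where the count falls back to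
zero. -/
theorem SameCycle.stepsTo_apply (h : σ.SameCycle a b) (hb : σ b ≠ a) :
    σ.stepsTo a (σ b) = σ.stepsTo a b + 1 := by
  apply le_antisymm
  · exact stepsTo_le (by rw [pow_succ', mul_apply, h.pow_stepsTo])
  · have h' := h.apply_right.pow_stepsTo
    rcases hm : σ.stepsTo a (σ b) with _ | m
    · rw [hm] at h'
      exact absurd h'.symm hb
    · rw [hm, pow_succ', mul_apply] at h'
      exact Nat.succ_le_succ (stepsTo_le (σ.injective h'))

theorem SameCycle.stepsTo_inj {c : α} (hb : σ.SameCycle a b) (hc : σ.SameCycle a c)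
    (h : σ.stepsTo a b = σ.stepsTo a c) : b = c := by
  rw [← hb.pow_stepsTo, h, hc.pow_stepsTo]

theorem stepsTo_pow {i : ℕ} (h : ∀ m, 0 < m → m ≤ i → (σ ^ m) a ≠ a) :
    σ.stepsTo a ((σ ^ i) a) = i := by
  induction i with
  | zero => exact stepsTo_self
  | succ i ih =>
    have h1 := h (i + 1) (Nat.succ_pos i) le_rfl
    rw [pow_succ', mul_apply] at h1 ⊢
    rw [SameCycle.stepsTo_apply ⟨i, by simp⟩ h1, ih fun m hm hmi => h m hm (by omega)]

end Equiv.Perm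

/-! ### Faces, their exits, and the tree decomposition on the arcs -/

namespace Network

variable {n : ℕ} {N : Network n} {r : Fin n}

theorem card_arc : Nat.card N.Arc = 2 * N.graph.edgeSet.ncard := by
  classical
  have h := N.graph.sum_degrees_eq_twice_card_edges
  rw [Nat.card_eq_fintype_card, Fintype.card_sigma, ← SimpleGraph.coe_edgeFinset,
    Set.ncard_coe_finset, ← h]
  refine Finset.sum_congr rfl fun v _ => ?_
  rw [← SimpleGraph.card_neighborSet_eq_degree, Fintype.card_congr (N.port v)]

namespace RootedSubtree

variable (T : N.RootedSubtree r)

theorem ncard_up (hT : ∀ v, v ∈ T.nodes) : T.up.ncard + 1 = n := by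
  have h1 : (Sigma.fst '' T.up).ncard = T.up.ncard :=
    Set.InjOn.ncard_image fun a ha b hb h => T.up_inj a ha b hb h
  have h2 : insert r (Sigma.fst '' T.up) = Set.univ :=
    Set.eq_univ_of_forall fun v => (hT v).imp id fun ⟨a, ha, h⟩ => ⟨a, ha, h⟩
  have h3 : r ∉ Sigma.fst '' T.up := fun ⟨a, ha, h⟩ => T.ne_root a ha h
  rw [← h1, ← Set.ncard_insert_of_notMem h3, h2, Set.ncard_univ, Nat.card_fin]

theorem rev_notMem_up {a : N.Arc} (ha : a ∈ T.up) : N.rev a ∉ T.up := fun h => by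
  have h1 := T.level_lt a ha
  have h2 := T.level_lt _ h
  rw [N.rev_rev] at h2
  omega

/-- The time at which the walk around the tree that starts with `a₀` arrives at `a`. -/
noncomputable def time (a₀ a : N.Arc) : ℕ := (N.contour T.arcs T.rev_mem_arcs).stepsTo a₀ a

/-- The arcs outside the tree whose opposite arcs come earlier in the walk around the tree. -/
def closing (a₀ : N.Arc) : Set N.Arc := {a | a ∉ T.arcs ∧ T.time a₀ (N.rev a) < T.time a₀ a}

theorem ne_of_mem_closing {a₀ a : N.Arc} (h : a ∈ T.closing a₀) : a ≠ a₀ := by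
  rintro rfl
  have h2 := h.2
  rw [time, time, Equiv.Perm.stepsTo_self] at h2
  omega

/-- The arcs at which the walk around the tree leaves a face, together with the first arc. -/
def exits (a₀ : N.Arc) : Set N.Arc := insert a₀ (T.closing a₀)

variable {a₀ : N.Arc}

section Spanning

variable (hT : ∀ v, v ∈ T.nodes)
include hT

theorem time_inj {a b : N.Arc} (h : T.time a₀ a = T.time a₀ b) : a = b :=
  (T.sameCycle_contour (hT _) (hT _)).stepsTo_inj (T.sameCycle_contour (hT _) (hT _)) h

theorem mem_closing_or {a : N.Arc} (ha : a ∉ T.arcs) : a ∈ T.closing a₀ ∨ N.rev a ∈ T.closing a₀ := by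
  have hne : T.time a₀ (N.rev a) ≠ T.time a₀ a := fun h => N.rev_ne a (T.time_inj hT h)
  rcases lt_or_gt_of_ne hne with h | h
  · exact Or.inl ⟨ha, h⟩
  · exact Or.inr ⟨fun h' => ha ((T.rev_mem_arcs a).1 h'), by rwa [N.rev_rev]⟩

/-- Take the arc of the face that comes last in the walk. If it is no exit, its successor on the
face comes later still: for a tree arc this is the next step of the walk; for an arc outside the
tree it is the step after the reverse, which itself comes later. The only exception is a successor
equal to `a₀`, and then `a₀` is on the face. -/
theorem exists_exit (a : N.Arc) : ∃ e ∈ T.exits a₀, N.facePerm.SameCycle e a := by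
  obtain ⟨m, hm, hmax⟩ := Set.exists_max_image {b | N.facePerm.SameCycle a b} (T.time a₀)
    (Set.toFinite _) ⟨a, Equiv.Perm.SameCycle.refl _ _⟩
  by_cases hex : m ∈ T.exits a₀
  · exact ⟨m, hex, hm.symm⟩
  by_cases h0 : N.facePerm m = a₀
  · exact ⟨a₀, Or.inl rfl, h0 ▸ (Equiv.Perm.SameCycle.apply_right hm).symm⟩
  exfalso
  have hle := hmax _ (Equiv.Perm.SameCycle.apply_right hm)
  by_cases ht : m ∈ T.arcs
  · have hc : N.facePerm m = N.contour T.arcs T.rev_mem_arcs m := (contour_of_mem ht).symm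
    rw [hc] at hle h0
    rw [time, (T.sameCycle_contour (hT _) (hT _)).stepsTo_apply h0, time] at hle
    omega
  · have hrc : N.rev m ∈ T.closing a₀ :=
      (T.mem_closing_or hT ht).resolve_left fun h => hex (Or.inr h)
    have hc : N.facePerm m = N.contour T.arcs T.rev_mem_arcs (N.rev m) :=
      (contour_of_notMem hrc.1).symm
    have hlt := hrc.2
    rw [N.rev_rev] at hlt
    rw [hc] at hle h0
    rw [time, (T.sameCycle_contour (hT _) (hT _)).stepsTo_apply h0] at hle
    rw [time, time] at hlt
    rw [time] at hle
    omega

/-- The upward tree arcs, the closing arcs and the reverses of both partition the arcs. This is the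
count that enters Euler's formula. -/
theorem card_arc_eq : Nat.card N.Arc = 2 * T.up.ncard + 2 * (T.closing a₀).ncard := by
  have hrev : ∀ s : Set N.Arc, (N.rev '' s).ncard = s.ncard := fun s =>
    Set.ncard_image_of_injective s N.rev_injective
  have hmem : ∀ (s : Set N.Arc) (a : N.Arc), a ∈ N.rev '' s ↔ N.rev a ∈ s := by
    intro s a
    constructor
    · rintro ⟨b, hb, rfl⟩
      rwa [N.rev_rev]
    · exact fun h => ⟨_, h, N.rev_rev a⟩
  have h1 : (T.up ∪ N.rev '' T.up).ncard = 2 * T.up.ncard := by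
    rw [Set.ncard_union_eq, hrev, two_mul]
    exact Set.disjoint_left.2 fun a ha h => T.rev_notMem_up ha ((hmem _ _).1 h)
  have h2 : (T.closing a₀ ∪ N.rev '' T.closing a₀).ncard = 2 * (T.closing a₀).ncard := by
    rw [Set.ncard_union_eq, hrev, two_mul]
    refine Set.disjoint_left.2 fun a ha h => ?_
    have h' := ((hmem _ _).1 h).2
    rw [N.rev_rev] at h'
    exact absurd ha.2 (not_lt.2 h'.le)
  rw [← h1, ← h2, ← Set.ncard_union_eq, ← Set.ncard_univ]
  · congr 1
    refine (Set.eq_univ_of_forall fun a => ?_).symm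
    by_cases ha : a ∈ T.arcs
    · exact Or.inl (ha.imp id (hmem _ _).2)
    · exact Or.inr ((T.mem_closing_or hT ha).imp id (hmem _ _).2)
  · refine Set.disjoint_left.2 fun a ha h => ?_
    have ha' : a ∈ T.arcs := ha.imp id (hmem _ _).1
    rcases h with h | h
    · exact h.1 ha'
    · exact ((hmem _ _).1 h).1 ((T.rev_mem_arcs a).2 ha')

/-- This is where planarity is used. A spanning tree has n - 1 links, so by Euler's formula there
are as many exits as faces; the surjection from exits to faces is therefore injective. -/
theorem exit_unique (hN : N.IsPlanarEmbedding) {e e' : N.Arc} (he : e ∈ T.exits a₀)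
    (he' : e' ∈ T.exits a₀) (h : N.facePerm.SameCycle e e') : e = e' := by
  have hcard : Nat.card (T.exits a₀) = N.faceCount := by
    have h1 := T.ncard_up hT
    have h2 := T.card_arc_eq hT (a₀ := a₀)
    have h3 : (T.exits a₀).ncard = (T.closing a₀).ncard + 1 :=
      Set.ncard_insert_of_notMem fun h => T.ne_of_mem_closing h rfl
    have h4 := card_arc (N := N)
    have h5 : n + N.faceCount = N.graph.edgeSet.ncard + 2 := hN
    rw [Nat.card_coe_set_eq]
    omega
  have hsurj : Function.Surjective fun x : T.exits a₀ =>
      (Quotient.mk (Equiv.Perm.SameCycle.setoid N.facePerm) x.1) := by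
    intro q
    induction q using Quotient.inductionOn with
    | _ a =>
      obtain ⟨x, hx, hxa⟩ := T.exists_exit hT (a₀ := a₀) a
      exact ⟨⟨x, hx⟩, Quotient.sound hxa⟩
  have hbij := hsurj.bijective_of_nat_card_le hcard.le
  exact congrArg Subtype.val (hbij.injective (a₁ := ⟨e, he⟩) (a₂ := ⟨e', he'⟩) (Quotient.sound h))

end Spanning

/-- The exit of the face to the boundary of which `a` belongs. -/
noncomputable def exitArc (a₀ a : N.Arc) : N.Arc :=
  @Classical.epsilon _ ⟨a⟩ fun e => e ∈ T.exits a₀ ∧ N.facePerm.SameCycle e a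

/-- The node to which the exit of the face of `a` leads. -/
noncomputable def apex (a₀ a : N.Arc) : Fin n := (N.rev (T.exitArc a₀ a)).1

/-- The father in the decomposition of the bag that belongs to the arc `a`. -/
noncomputable def fatherArc (a₀ a : N.Arc) : Option N.Arc :=
  open Classical in
  if a = a₀ then none else if a ∈ T.closing a₀ then some (N.rev a) else some (N.facePerm a)

/-- The bag that belongs to the arc `a`. -/
def bag (a₀ a : N.Arc) : Set (Fin n) :=
  {x | T.Below x (T.apex a₀ a) ∨ T.Below x a.1 ∨ T.Below x (N.rev a).1}

theorem fatherArc_root : T.fatherArc a₀ a₀ = none := if_pos rfl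

theorem fatherArc_of_mem_closing {a : N.Arc} (h : a ∈ T.closing a₀) :
    T.fatherArc a₀ a = some (N.rev a) := by
  rw [fatherArc, if_neg (T.ne_of_mem_closing h), if_pos h]

theorem fatherArc_of_notMem_exits {a : N.Arc} (h : a ∉ T.exits a₀) :
    T.fatherArc a₀ a = some (N.facePerm a) := by
  rw [fatherArc, if_neg fun h' => h (Or.inl h'), if_neg fun h' => h (Or.inr h')]

section Planar

variable (hT : ∀ v, v ∈ T.nodes)
include hT

theorem exitArc_spec (a : N.Arc) :
    T.exitArc a₀ a ∈ T.exits a₀ ∧ N.facePerm.SameCycle (T.exitArc a₀ a) a :=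
  Classical.epsilon_spec (p := fun e => e ∈ T.exits a₀ ∧ N.facePerm.SameCycle e a)
    (T.exists_exit hT a)

variable (hN : N.IsPlanarEmbedding)
include hN

theorem exitArc_eq {e a : N.Arc} (he : e ∈ T.exits a₀) (h : N.facePerm.SameCycle e a) :
    T.exitArc a₀ a = e :=
  T.exit_unique hT hN (T.exitArc_spec hT a).1 he ((T.exitArc_spec hT a).2.trans h.symm)

theorem apex_eq_of_sameCycle {a b : N.Arc} (h : N.facePerm.SameCycle a b) :
    T.apex a₀ a = T.apex a₀ b := by
  rw [apex, apex, T.exitArc_eq hT hN (T.exitArc_spec hT a).1 ((T.exitArc_spec hT a).2.trans h)]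

theorem apex_of_mem_exits {e : N.Arc} (he : e ∈ T.exits a₀) : T.apex a₀ e = (N.rev e).1 := by
  rw [apex, T.exitArc_eq hT hN he (Equiv.Perm.SameCycle.refl _ _)]

theorem apex_facePerm (a : N.Arc) : T.apex a₀ (N.facePerm a) = T.apex a₀ a :=
  (T.apex_eq_of_sameCycle hT hN (Equiv.Perm.SameCycle.refl _ _).apply_right).symm

/-- Three facts combine. `face`: a face whose apex is below `x` is connected within the bags of `x`,
since only the step at its exit is not a father step. `step`: an arc with head below `x` is
connected to its successor on the face, by a father step or, at an exit, because its head is the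
apex. `tails`: these steps, together with the father steps between closing arcs and their reverses,
make up the walk around the part of the tree below `x`. Every bag of `x` is then joined to one of an
arc with tail below `x`. -/
theorem eqvGen_of_mem_bag {x : Fin n} {a b : N.Arc} (ha : x ∈ T.bag a₀ a) (hb : x ∈ T.bag a₀ b) :
    Relation.EqvGen (fun a b => x ∈ T.bag a₀ a ∧ x ∈ T.bag a₀ b ∧ T.fatherArc a₀ a = some b)
      a b := by
  set E : N.Arc → N.Arc → Prop :=
    fun a b => x ∈ T.bag a₀ a ∧ x ∈ T.bag a₀ b ∧ T.fatherArc a₀ a = some b with hE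
  have hR : Equivalence (Relation.EqvGen E) := Relation.EqvGen.is_equivalence E
  have face : ∀ c d : N.Arc, T.Below x (T.apex a₀ c) → N.facePerm.SameCycle c d →
      Relation.EqvGen E c d := by
    intro c d hc hcd
    obtain ⟨he, hec⟩ := T.exitArc_spec hT (a₀ := a₀) c
    refine Equiv.Perm.SameCycle.rel_of_forall_ne hR ?_ hec (hec.trans hcd)
    intro y hy hne
    have hya : T.apex a₀ y = T.apex a₀ c :=
      T.apex_eq_of_sameCycle hT hN (hy.symm.trans hec)
    have hyx : y ∉ T.exits a₀ := fun h => hne (T.exit_unique hT hN h he hy.symm)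
    refine Relation.EqvGen.rel _ _ ⟨Or.inl (hya ▸ hc), Or.inl ?_, T.fatherArc_of_notMem_exits hyx⟩
    rw [T.apex_facePerm hT hN, hya]
    exact hc
  have step : ∀ c : N.Arc, T.Below x (N.rev c).1 → Relation.EqvGen E c (N.facePerm c) := by
    intro c hc
    by_cases hex : c ∈ T.exits a₀
    · exact face _ _ (by rwa [T.apex_of_mem_exits hT hN hex])
        (Equiv.Perm.SameCycle.refl _ _).apply_right
    · exact Relation.EqvGen.rel _ _
        ⟨Or.inr (Or.inr hc), Or.inr (Or.inl hc), T.fatherArc_of_notMem_exits hex⟩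
  have tails : ∀ c d : N.Arc, T.Below x c.1 → T.Below x d.1 → Relation.EqvGen E c d := by
    refine fun c d => T.rel_of_below hR (fun c hc hx => ?_) fun c _ hx => step c hx
    have h1 : Relation.EqvGen E c (N.rev c) := by
      have hm1 : x ∈ T.bag a₀ c := Or.inr (Or.inl hx)
      have hm2 : x ∈ T.bag a₀ (N.rev c) := Or.inr (Or.inr (by rwa [N.rev_rev]))
      rcases T.mem_closing_or hT (a₀ := a₀) hc with h | h
      · exact Relation.EqvGen.rel _ _ ⟨hm1, hm2, T.fatherArc_of_mem_closing h⟩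
      · refine hR.symm (Relation.EqvGen.rel _ _ ⟨hm2, hm1, ?_⟩)
        rw [T.fatherArc_of_mem_closing h, N.rev_rev]
    have h2 := step (N.rev c) (by rwa [N.rev_rev])
    rw [facePerm_apply, N.rev_rev] at h2
    exact hR.trans h1 h2
  have toTail : ∀ c : N.Arc, x ∈ T.bag a₀ c → ∃ d : N.Arc, T.Below x d.1 ∧ Relation.EqvGen E c d := by
    rintro c (hc | hc | hc)
    · refine ⟨N.facePerm (T.exitArc a₀ c), hc, face _ _ hc ?_⟩
      exact (T.exitArc_spec hT c).2.symm.apply_right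
    · exact ⟨c, hc, hR.refl c⟩
    · exact ⟨N.facePerm c, hc, step c hc⟩
  obtain ⟨c, hc, hac⟩ := toTail a ha
  obtain ⟨d, hd, hbd⟩ := toTail b hb
  exact hR.trans hac (hR.trans (tails c d hc hd) (hR.symm hbd))

/-- All bags contain `r`, so every arc is connected to `a₀` by father steps in either direction.
Since fathers are unique and `a₀` has none, reaching `a₀` is invariant under each such step, which
rules out cycles. -/
theorem reaches_root (a : N.Arc) :
    Relation.ReflTransGen (fun s u => T.fatherArc a₀ s = some u) a a₀ := by
  have hmem : ∀ b, r ∈ T.bag a₀ b := fun b => Or.inl (T.below_root_of_mem_nodes (hT _))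
  have h := T.eqvGen_of_mem_bag hT hN (hmem a) (hmem a₀)
  suffices H : ∀ {b c : N.Arc}, Relation.EqvGen
      (fun a b => r ∈ T.bag a₀ a ∧ r ∈ T.bag a₀ b ∧ T.fatherArc a₀ a = some b) b c →
      (Relation.ReflTransGen (fun s u => T.fatherArc a₀ s = some u) b a₀ ↔
        Relation.ReflTransGen (fun s u => T.fatherArc a₀ s = some u) c a₀) from
    (H h).2 Relation.ReflTransGen.refl
  intro b c hbc
  induction hbc with
  | rel b c hbc =>
    constructor
    · intro hb
      rcases Relation.ReflTransGen.cases_head hb with rfl | ⟨u, hu, hb⟩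
      · rw [T.fatherArc_root] at hbc
        exact absurd hbc.2.2 (by simp)
      · rw [hbc.2.2, Option.some_inj] at hu
        rwa [hu]
    · exact fun hc => Relation.ReflTransGen.head hbc.2.2 hc
  | refl => exact Iff.rfl
  | symm _ _ _ ih => exact ih.symm
  | trans _ _ _ _ _ ih₁ ih₂ => exact ih₁.trans ih₂

/-- The rooted tree of the decomposition, on the set of arcs. -/
noncomputable def decompositionTree (a₀ : N.Arc) : RootedTreeOn N.Arc where
  root := a₀
  father := T.fatherArc a₀
  father_root := T.fatherArc_root
  reaches_root := T.reaches_root hT hN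

theorem isTreeDecomposition (h₀ : a₀.1 = r) :
    IsTreeDecomposition N.graph (T.decompositionTree hT hN a₀) (T.bag a₀) where
  edge_mem v w h := by
    obtain ⟨a, rfl, rfl⟩ := N.exists_arc h
    exact ⟨a, Or.inr (Or.inl Relation.ReflTransGen.refl),
      Or.inr (Or.inr Relation.ReflTransGen.refl)⟩
  connected v := by
    rw [SimpleGraph.connected_iff]
    constructor
    · rintro ⟨a, ha⟩ ⟨b, hb⟩
      have h := T.eqvGen_of_mem_bag hT hN ha hb
      suffices H : ∀ {a b : N.Arc}, Relation.EqvGen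
          (fun a b => v ∈ T.bag a₀ a ∧ v ∈ T.bag a₀ b ∧ T.fatherArc a₀ a = some b) a b →
          a = b ∨ ∃ (ha : v ∈ T.bag a₀ a) (hb : v ∈ T.bag a₀ b),
            ((T.decompositionTree hT hN a₀).graph.induce {t | v ∈ T.bag a₀ t}).Reachable
              ⟨a, ha⟩ ⟨b, hb⟩ by
        rcases H h with rfl | ⟨_, _, h⟩
        · exact SimpleGraph.Reachable.refl _
        · exact h
      intro a b hab
      induction hab with
      | rel a b hab =>
        by_cases hne : a = b
        · exact Or.inl hne
        refine Or.inr ⟨hab.1, hab.2.1, SimpleGraph.Adj.reachable ?_⟩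
        exact ⟨hne, Or.inl hab.2.2⟩
      | refl => exact Or.inl rfl
      | symm _ _ _ ih =>
        rcases ih with rfl | ⟨h1, h2, h⟩
        · exact Or.inl rfl
        · exact Or.inr ⟨h2, h1, h.symm⟩
      | trans _ _ _ _ _ ih₁ ih₂ =>
        rcases ih₁ with rfl | ⟨h1, h2, h⟩
        · exact ih₂
        · rcases ih₂ with rfl | ⟨h1', h2', h'⟩
          · exact Or.inr ⟨h1, h2, h⟩
          · exact Or.inr ⟨h1, h2', h.trans h'⟩
    · rcases hT v with h | ⟨a, -, rfl⟩
      · refine ⟨⟨a₀, Or.inr (Or.inl ?_)⟩⟩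
        rw [h₀, h]
        exact Relation.ReflTransGen.refl
      · exact ⟨⟨a, Or.inr (Or.inl Relation.ReflTransGen.refl)⟩⟩

end Planar

end RootedSubtree

/-! ### A linear bound on the number of arcs -/

theorem exists_ne_neighbor (h : N.graph.IsBiconnected) (v u : Fin n) :
    ∃ w, w ≠ u ∧ N.graph.Adj v w := by
  obtain ⟨hcard, hconn, hind⟩ := h
  rw [Nat.card_fin] at hcard
  have hex : ∃ x : Fin n, x ≠ v ∧ x ≠ u := by
    by_contra hcon
    push Not at hcon
    have h1 : (Finset.univ : Finset (Fin n)) ⊆ {v, u} := fun x _ => by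
      by_cases hx : x = v
      · simp [hx]
      · simp [hcon x hx]
    have h2 := (Finset.card_le_card h1).trans Finset.card_le_two
    rw [Finset.card_univ, Fintype.card_fin] at h2
    omega
  obtain ⟨x, hxv, hxu⟩ := hex
  by_cases hvu : v = u
  · have : Nontrivial (Fin n) := ⟨⟨x, v, hxv⟩⟩
    obtain ⟨w, hw⟩ := hconn.preconnected.exists_adj_of_nontrivial v
    exact ⟨w, fun h => hw.ne (hvu.trans h.symm), hw⟩
  · have hnt : Nontrivial ({u}ᶜ : Set (Fin n)) :=
      ⟨⟨⟨x, hxu⟩, ⟨v, hvu⟩, fun h => hxv (congrArg Subtype.val h)⟩⟩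
    obtain ⟨w, hw⟩ := (hind u).preconnected.exists_adj_of_nontrivial ⟨v, hvu⟩
    exact ⟨w, w.2, hw⟩

/-- The cyclic ordering at a node is a single cycle, so a fixed arc would be the only arc there,
against the second neighbor that biconnectivity provides. -/
theorem turn_ne (h : N.graph.IsBiconnected) (a : N.Arc) : N.turn a ≠ a := by
  intro ha
  obtain ⟨w, hw, hadj⟩ := exists_ne_neighbor h a.1 (N.rev a).1
  obtain ⟨b, hb, rfl⟩ := N.exists_arc hadj
  obtain ⟨i, -, -, rfl⟩ := (N.sameCycle_turn hb.symm).exists_pow_eq''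
  exact hw (by rw [Function.IsFixedPt.perm_pow ha i])

/-- Each face has at least three arcs: successive arcs have different tails, and a face of two arcs
would need a node of degree one. -/
theorem three_mul_faceCount_le (h : N.graph.IsBiconnected) : 3 * N.faceCount ≤ Nat.card N.Arc := by
  classical
  set s := Equiv.Perm.SameCycle.setoid N.facePerm
  have : Fintype (Quotient s) := Fintype.ofFinite _
  rw [faceCount, Nat.card_eq_fintype_card, Nat.card_eq_fintype_card, ← Finset.card_univ,
    ← Finset.card_univ]
  refine Finset.mul_card_image_le_card_of_maps_to (f := fun a : N.Arc => (Quotient.mk s a))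
    (fun _ _ => Finset.mem_univ _) 3 fun q _ => ?_
  induction q using Quotient.inductionOn with
  | _ a =>
    have h1 : ∀ b : N.Arc, N.facePerm b ≠ b := fun b hb => by
      have h : (N.facePerm b).1 = b.1 := by rw [hb]
      exact N.rev_fst_ne b h
    have h2 : N.facePerm (N.facePerm a) ≠ a := by
      intro hb
      have h' : (N.facePerm (N.facePerm a)).1 = a.1 := by rw [hb]
      exact turn_ne h (N.rev a) (N.arc_ext rfl (h'.trans (N.neighbor_rev a).symm))
    have hsub : {a, N.facePerm a, N.facePerm (N.facePerm a)} ⊆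
        Finset.univ.filter fun b : N.Arc => Quotient.mk s b = Quotient.mk s a := by
      have hr : N.facePerm.SameCycle a a := Equiv.Perm.SameCycle.refl _ _
      intro b hb
      simp only [Finset.mem_insert, Finset.mem_singleton] at hb
      refine Finset.mem_filter.2 ⟨Finset.mem_univ _, Quotient.sound ?_⟩
      rcases hb with rfl | rfl | rfl
      · exact hr
      · exact hr.apply_right.symm
      · exact hr.apply_right.apply_right.symm
    refine le_trans (le_of_eq ?_) (Finset.card_le_card hsub)
    rw [Finset.card_eq_three.2 ⟨_, _, _, (h1 a).symm, h2.symm, (h1 _).symm, rfl⟩]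

theorem card_arc_le (h : N.graph.IsBiconnected) (hN : N.IsPlanarEmbedding) :
    Nat.card N.Arc ≤ 6 * n := by
  have h1 := three_mul_faceCount_le h
  have h2 := card_arc (N := N)
  have h3 : n + N.faceCount = N.graph.edgeSet.ncard + 2 := hN
  omega

end Network

/-! ### Encoding of messages -/

/-- A self-delimiting code of the natural numbers. -/
def encodeNat (x : ℕ) : Message := (Nat.digits 2 x).flatMap (fun d => [true, d == 1]) ++ [false]

def encodeNats (l : List ℕ) : Message := l.flatMap encodeNat

/-- Decodes a list of numbers; `acc` holds the digits of the first number that have been read. -/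
def decodeNats : Message → List ℕ → List ℕ
  | true :: b :: m, acc => decodeNats m (acc ++ [if b then 1 else 0])
  | false :: m, acc => Nat.ofDigits 2 acc :: decodeNats m []
  | _, _ => []

theorem decodeNats_digits (ds : List ℕ) (hds : ∀ d ∈ ds, d < 2) (m : Message) (acc : List ℕ) :
    decodeNats (ds.flatMap (fun d => [true, d == 1]) ++ m) acc = decodeNats m (acc ++ ds) := by
  induction ds generalizing acc with
  | nil => simp
  | cons d ds ih =>
    have hd : (if (d == 1) = true then 1 else 0) = d := by
      have := hds d (by simp)
      interval_cases d <;> rfl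
    rw [List.flatMap_cons, List.append_assoc]
    change decodeNats (_ ++ m) (acc ++ [if (d == 1) = true then 1 else 0]) = _
    rw [ih fun x hx => hds x (by simp [hx]), hd]
    simp

theorem decodeNats_encodeNats (l : List ℕ) : decodeNats (encodeNats l) [] = l := by
  induction l with
  | nil => rfl
  | cons x l ih =>
    have h := decodeNats_digits (Nat.digits 2 x) (fun d hd => Nat.digits_lt_base (by norm_num) hd)
      ([false] ++ encodeNats l) []
    rw [encodeNats, List.flatMap_cons, encodeNat, List.append_assoc, ← encodeNats, h]
    change Nat.ofDigits 2 (Nat.digits 2 x) :: decodeNats (encodeNats l) [] = _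
    rw [ih, Nat.ofDigits_digits]

/-- Two bits for each of at most log M + 1 binary digits, and one bit for the end mark. -/
theorem length_encodeNat_le {x M : ℕ} (h : x ≤ M) :
    (encodeNat x).length ≤ 2 * Nat.log 2 M + 3 := by
  have h1 : (Nat.digits 2 x).length ≤ Nat.log 2 M + 1 := by
    rcases Nat.eq_zero_or_pos x with rfl | hx
    · simp
    · rw [Nat.length_digits 2 x (by norm_num) hx.ne']
      exact Nat.succ_le_succ (Nat.log_mono_right h)
  have h2 : ∀ ds : List ℕ, (ds.flatMap fun d => [true, d == 1]).length = 2 * ds.length := by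
    intro ds
    induction ds with
    | nil => rfl
    | cons d ds ih => simp [ih]; omega
  rw [encodeNat, List.length_append, h2, List.length_singleton]
  omega

theorem length_encodeNats_le {l : List ℕ} {M : ℕ} (h : ∀ x ∈ l, x ≤ M) :
    (encodeNats l).length ≤ l.length * (2 * Nat.log 2 M + 3) := by
  induction l with
  | nil => simp [encodeNats]
  | cons x l ih =>
    have h1 := ih fun y hy => h y (by simp [hy])
    have h2 := length_encodeNat_le (h x (by simp))
    rw [encodeNats, List.flatMap_cons, List.length_append, List.length_cons, ← encodeNats]
    linarith

/-- The kinds of messages: `move` passes the token on along a link of the tree; `probe` is sent over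
another link, and is answered by `accept` if the receiver joins the tree as a child of the sender,
and by `reject` otherwise. -/
inductive Kind
  | probe
  | reject
  | accept
  | move

def Kind.toNat : Kind → ℕ
  | probe => 0
  | reject => 1
  | accept => 2
  | move => 3

def Kind.ofNat : ℕ → Kind
  | 0 => probe
  | 1 => reject
  | 2 => accept
  | _ => move

/-- The contents of a message: its kind, the number of the round, the port over which it is sent and
the preceding port in the cyclic ordering, the path of the tree from the sender to the root, and the
path of the apex of the current face. -/
structure Token where
  kind : Kind
  round : ℕ
  port : ℕ
  prev : ℕ
  path : List ℕ
  carry : List ℕ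

def Token.encode (t : Token) : Message :=
  encodeNats (t.kind.toNat :: t.round :: t.port :: t.prev :: t.path.length :: (t.path ++ t.carry))

def Token.decode (m : Message) : Token :=
  match decodeNats m [] with
  | a :: b :: c :: d :: l :: x => ⟨Kind.ofNat a, b, c, d, x.take l, x.drop l⟩
  | _ => ⟨Kind.move, 0, 0, 0, [], []⟩

theorem Token.decode_encode (t : Token) : Token.decode t.encode = t := by
  obtain ⟨kind, round, port, prev, path, carry⟩ := t
  simp only [Token.decode, Token.encode, decodeNats_encodeNats, List.take_left', List.drop_left']
  cases kind <;> rfl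

/-! ### The algorithm -/

/-- The state of a node. The node knows whether it is the requesting node, and stores
* the path of identifiers to the root of the tree, empty as long as the node is not in the tree;
* for each port that belongs to a link of the tree, the level of the child at this link;
* for each port what it has heard about the neighbor: its port for the link, the port preceding this
  one in the cyclic ordering of the neighbor, and its path to the root;
* for each round and port the path of the apex that came with a probe;
* for each port the path of the apex of the face of the outgoing arc, and whether the face is left
  by this arc. -/
structure NodeState where
  root : Bool
  path : List ℕ
  link : ℕ → Option ℕ
  heard : ℕ → Option (ℕ × ℕ × List ℕ)
  crossed : ℕ → ℕ → Option (List ℕ)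
  apex : ℕ → List ℕ
  exit : ℕ → Bool

namespace NodeState

variable (s : NodeState)

/-- The exit flag is read off at departure: it is set when the same link has already been probed
from its other end in this round, that is, when the reverse arc came earlier in the walk. -/
def visit (j p : ℕ) (z : List ℕ) : NodeState :=
  { s with
    apex := Function.update s.apex p z
    exit := Function.update s.exit p (s.crossed j p).isSome }

def hear (p : ℕ) (x : ℕ × ℕ × List ℕ) : NodeState :=
  { s with heard := Function.update s.heard p (some x) }

/-- Entries are indexed by the round, so marks of earlier rounds do no harm and never have to be
erased. -/
def cross (j p : ℕ) (z : List ℕ) : NodeState :=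
  { s with crossed := Function.update s.crossed j (Function.update (s.crossed j) p (some z)) }

def attach (p l : ℕ) : NodeState :=
  { s with link := Function.update s.link p (some l) }

def join (ident p l : ℕ) (path : List ℕ) : NodeState :=
  { s with
    path := ident :: path
    link := Function.update s.link p (some l) }

/-- The kind of message by which the token leaves over the port `p` in the round `j`. -/
def kind (j p : ℕ) : Kind :=
  if (s.link p).any (· ≤ j) then Kind.move else Kind.probe

/-- The path of the apex of the face that the token enters after it has passed the port `p`, which
does not belong to the tree. -/
def carryAfter (j p : ℕ) : List ℕ := (s.crossed j p).getD s.path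

/-- The path of the first neighbor of the root. -/
def firstCarry : List ℕ := ((s.heard 0).map fun x => x.2.2).getD []

end NodeState

namespace LocalInput

variable (inp : LocalInput)

/-- The sender also announces its preceding port, because the receiver may need it as the number of
a father bag: that port carries the next arc of the face after the arc leading to the sender. -/
def token (s : NodeState) (κ : Kind) (j : ℕ) (p : Fin inp.deg) (z : List ℕ) : Token :=
  ⟨κ, j, p, inp.rot.symm p, s.path, z⟩

/-- The token, which is at the port `p`, leaves over this port. -/
def launch (s : NodeState) (j : ℕ) (p : Fin inp.deg) (z : List ℕ) :
    NodeState × List (Fin inp.deg × Message) :=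
  (s.visit j p z, [(p, (inp.token s (s.kind j p) j p z).encode)])

/-- The token passes from the port `q` to the preceding port. The requesting node starts the next
round, or ends the computation, when the token arrives at its first port. -/
def advance (s : NodeState) (j : ℕ) (q : Fin inp.deg) (z : List ℕ) :
    NodeState × List (Fin inp.deg × Message) :=
  if s.root = true ∧ (inp.rot.symm q : ℕ) = 0 then
    if j = inp.k then (s, []) else inp.launch s (j + 1) (inp.rot.symm q) s.firstCarry
  else inp.launch s j (inp.rot.symm q) z

def reply (s : NodeState) (κ : Kind) (j : ℕ) (q : Fin inp.deg) :
    NodeState × List (Fin inp.deg × Message) :=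
  (s, [(q, (inp.token s κ j q []).encode)])

/-- Both answers to a probe bring the token back to the probing node, which turns to its preceding
port; they differ only in whether a tree link is recorded. -/
def react (s : NodeState) (q : Fin inp.deg) (t : Token) :
    NodeState × List (Fin inp.deg × Message) :=
  let s₁ := s.hear q (t.port, t.prev, t.path)
  match t.kind with
  | Kind.move => inp.advance s₁ t.round q t.carry
  | Kind.probe =>
    let s₂ := s₁.cross t.round q t.carry
    if s₂.path = [] then
      inp.reply (s₂.join inp.ident q (t.round + 1) t.path) Kind.accept t.round q
    else inp.reply s₂ Kind.reject t.round q
  | Kind.reject => inp.advance s₁ t.round q (s₁.carryAfter t.round q)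
  | Kind.accept =>
    inp.advance (s₁.attach q (t.round + 1)) t.round q (s₁.carryAfter t.round q)

/-- The root is dropped from two of the three paths, and unused entries are filled with the root,
the last entry of the third path. Bags are numbered by ports, so the father's number is the
neighbor's port for the link (reverse arc) or its preceding port (next arc of the face). -/
def storedBag (s : NodeState) (p : Fin inp.deg) : StoredBag (3 * inp.k) inp.deg :=
  let x := (s.heard p).getD (0, 0, [])
  { label := fun i =>
      ((s.apex p).dropLast ++ s.path.dropLast ++ x.2.2).getD i (x.2.2.getLast?.getD 0)
    father :=
      if s.root = true ∧ (p : ℕ) = 0 then none else some (p, if s.exit p then x.1 else x.2.1) }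

end LocalInput

/-- The algorithm: the token makes `k + 1` rounds. In the round `j` it walks around the breadth-first
tree up to the level `j`, and probes all other links of the nodes of this tree. -/
abbrev decompositionAlgorithm : DistAlgorithm BagList where
  State := NodeState
  initState _ := ⟨false, [], fun _ => none, fun _ => none, fun _ _ => none, fun _ => [], fun _ => false⟩
  start inp s :=
    if h : 0 < inp.deg then inp.launch { s with root := true, path := [inp.ident] } 0 ⟨0, h⟩ []
    else (s, [])
  receive inp s q m := inp.react s q (Token.decode m)
  output inp s := List.ofFn (inp.storedBag s)

/-! ### The global state of the network -/

namespace Network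

variable {n : ℕ} (N : Network n)

/-- The values of a function of the arcs at the ports of the node `v`. -/
def atPorts {β : Type} (f : N.Arc → β) (d : β) (v : Fin n) (p : ℕ) : β :=
  if h : p < N.deg v then f ⟨v, p, h⟩ else d

variable {N} {β : Type} {f : N.Arc → β} {d x : β} {a : N.Arc}

theorem atPorts_port : N.atPorts f d a.1 a.2 = f a := dif_pos a.2.2

theorem atPorts_update_self :
    N.atPorts (Function.update f a x) d a.1 = Function.update (N.atPorts f d a.1) a.2 x := by
  funext p
  by_cases hp : p = a.2
  · rw [hp, atPorts_port, Function.update_self, Function.update_self]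
  · rw [Function.update_of_ne hp, atPorts, atPorts]
    split_ifs with h
    · refine Function.update_of_ne (fun h' => hp ?_) _ _
      rw [← h']
    · rfl

theorem atPorts_update_of_ne {v : Fin n} (h : v ≠ a.1) :
    N.atPorts (Function.update f a x) d v = N.atPorts f d v := by
  funext p
  rw [atPorts, atPorts]
  split_ifs with hp
  · refine Function.update_of_ne (fun h' => h ?_) _ _
    rw [← h']
  · rfl

end Network

/-- The states of all nodes together, as functions of the nodes and arcs, and the tree built so far:
its arcs from children to fathers and the levels of its nodes. -/
structure GlobalState {n : ℕ} (N : Network n) where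
  path : Fin n → List ℕ
  level : Fin n → ℕ
  up : Set N.Arc
  link : N.Arc → Option ℕ
  heard : N.Arc → Option (ℕ × ℕ × List ℕ)
  crossed : ℕ → N.Arc → Option (List ℕ)
  apex : N.Arc → List ℕ
  exit : N.Arc → Bool

namespace GlobalState

variable {n : ℕ} {N : Network n} (G : GlobalState N) (r : Fin n)

/-- The state of the node `v`. -/
def loc (v : Fin n) : NodeState where
  root := decide (v = r)
  path := G.path v
  link := N.atPorts G.link none v
  heard := N.atPorts G.heard none v
  crossed j := N.atPorts (G.crossed j) none v
  apex := N.atPorts G.apex [] v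
  exit := N.atPorts G.exit false v

/-- What the head of the arc `a` hears of the tail by a message along `a`. -/
def info (a : N.Arc) : ℕ × ℕ × List ℕ := (a.2, (N.turn a).2, G.path a.1)

def visit (j : ℕ) (a : N.Arc) (z : List ℕ) : GlobalState N :=
  { G with
    apex := Function.update G.apex a z
    exit := Function.update G.exit a (G.crossed j a).isSome }

/-- A message arrives that was sent along the arc `a`. -/
def hear (a : N.Arc) : GlobalState N :=
  { G with heard := Function.update G.heard (N.rev a) (some (G.info a)) }

def cross (j : ℕ) (a : N.Arc) (z : List ℕ) : GlobalState N :=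
  { G with
    crossed := Function.update G.crossed j (Function.update (G.crossed j) a (some z)) }

def attach (a : N.Arc) (l : ℕ) : GlobalState N :=
  { G with link := Function.update G.link a (some l) }

/-- The tail of `a` joins the tree at the level `l` as a child of the head of `a`. -/
def join (a : N.Arc) (l : ℕ) : GlobalState N :=
  { G with
    path := Function.update G.path a.1 (((a.1 : ℕ) + 1) :: G.path (N.rev a).1)
    level := Function.update G.level a.1 l
    up := insert a G.up
    link := Function.update G.link a (some l) }

/-- This and the next four lemmas let the proof work with one global state: each global operation
changes the view of a single node, by the local operation of the same name. -/
theorem loc_visit (j : ℕ) (a : N.Arc) (z : List ℕ) :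
    (G.visit j a z).loc r = Function.update (G.loc r) a.1 ((G.loc r a.1).visit j a.2 z) := by
  funext v
  by_cases h : v = a.1
  · subst h
    rw [Function.update_self]
    simp only [loc, visit, NodeState.visit, Network.atPorts_update_self, Network.atPorts_port]
  · rw [Function.update_of_ne h]
    simp only [loc, visit, Network.atPorts_update_of_ne h]

theorem loc_hear (a : N.Arc) :
    (G.hear a).loc r = Function.update (G.loc r) (N.rev a).1
      ((G.loc r (N.rev a).1).hear (N.rev a).2 (G.info a)) := by
  funext v
  by_cases h : v = (N.rev a).1
  · subst h
    rw [Function.update_self]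
    simp only [loc, hear, NodeState.hear, Network.atPorts_update_self]
  · rw [Function.update_of_ne h]
    simp only [loc, hear, Network.atPorts_update_of_ne h]

theorem loc_cross (j : ℕ) (a : N.Arc) (z : List ℕ) :
    (G.cross j a z).loc r = Function.update (G.loc r) a.1 ((G.loc r a.1).cross j a.2 z) := by
  funext v
  have hc : ∀ w, (fun i => N.atPorts (Function.update G.crossed j
      (Function.update (G.crossed j) a (some z)) i) none w) = Function.update
      (fun i => N.atPorts (G.crossed i) none w) j
      (N.atPorts (Function.update (G.crossed j) a (some z)) none w) := by
    intro w
    funext i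
    by_cases hi : i = j
    · subst hi
      rw [Function.update_self, Function.update_self]
    · rw [Function.update_of_ne hi, Function.update_of_ne hi]
  by_cases h : v = a.1
  · subst h
    rw [Function.update_self]
    simp only [loc, cross, NodeState.cross, hc, Network.atPorts_update_self]
  · rw [Function.update_of_ne h]
    simp only [loc, cross, hc, Network.atPorts_update_of_ne h, Function.update_eq_self]

theorem loc_attach (a : N.Arc) (l : ℕ) :
    (G.attach a l).loc r = Function.update (G.loc r) a.1 ((G.loc r a.1).attach a.2 l) := by
  funext v
  by_cases h : v = a.1
  · subst h
    rw [Function.update_self]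
    simp only [loc, attach, NodeState.attach, Network.atPorts_update_self]
  · rw [Function.update_of_ne h]
    simp only [loc, attach, Network.atPorts_update_of_ne h]

theorem loc_join (a : N.Arc) (l : ℕ) :
    (G.join a l).loc r = Function.update (G.loc r) a.1
      ((G.loc r a.1).join ((a.1 : ℕ) + 1) a.2 l (G.path (N.rev a).1)) := by
  funext v
  by_cases h : v = a.1
  · subst h
    rw [Function.update_self]
    simp only [loc, join, NodeState.join, Network.atPorts_update_self, Function.update_self]
  · rw [Function.update_of_ne h]
    simp only [loc, join, Network.atPorts_update_of_ne h, Function.update_of_ne h]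

end GlobalState

/-! ### Correctness of the tree under construction -/

namespace GlobalState

variable {n : ℕ} {N : Network n}

/-- The nodes with non-empty paths form a tree with root `r` and levels at most `l`, and the nodes
have correct information about this tree. -/
structure IsTree (G : GlobalState N) (r : Fin n) (l : ℕ) : Prop where
  root_path : G.path r = [(r : ℕ) + 1]
  root_level : G.level r = 0
  level_le : ∀ v, G.path v ≠ [] → G.level v ≤ l
  up_inj : ∀ a ∈ G.up, ∀ b ∈ G.up, a.1 = b.1 → a = b
  up_path : ∀ a ∈ G.up, G.path a.1 = ((a.1 : ℕ) + 1) :: G.path (N.rev a).1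
  up_head : ∀ a ∈ G.up, G.path (N.rev a).1 ≠ []
  up_level : ∀ a ∈ G.up, G.level (N.rev a).1 < G.level a.1
  up_ne : ∀ a ∈ G.up, a.1 ≠ r
  exists_up : ∀ v, G.path v ≠ [] → v = r ∨ ∃ a ∈ G.up, a.1 = v
  link_iff : ∀ a i, G.link a = some i ↔
    (a ∈ G.up ∧ G.level a.1 = i) ∨ (N.rev a ∈ G.up ∧ G.level (N.rev a).1 = i)
  heard_eq : ∀ a x, G.heard (N.rev a) = some x → x = G.info a ∧ G.path a.1 ≠ []
  length_path : ∀ v, (G.path v).length ≤ G.level v + 1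
  mem_path : ∀ v, ∀ x ∈ G.path v, ∃ u : Fin n, x = u + 1

namespace IsTree

variable {G : GlobalState N} {r : Fin n} {l : ℕ}

theorem mono (h : G.IsTree r l) {l' : ℕ} (hl : l ≤ l') : G.IsTree r l' :=
  { h with level_le := fun v hv => (h.level_le v hv).trans hl }

theorem visit (h : G.IsTree r l) (j : ℕ) (a : N.Arc) (z : List ℕ) : (G.visit j a z).IsTree r l :=
  { h with }

theorem cross (h : G.IsTree r l) (j : ℕ) (a : N.Arc) (z : List ℕ) : (G.cross j a z).IsTree r l :=
  { h with }

theorem hear (h : G.IsTree r l) {a : N.Arc} (ha : G.path a.1 ≠ []) : (G.hear a).IsTree r l :=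
  { h with
    heard_eq := by
      intro b x hx
      change Function.update G.heard (N.rev a) (some (G.info a)) (N.rev b) = some x at hx
      by_cases hb : b = a
      · subst hb
        rw [Function.update_self, Option.some_inj] at hx
        exact ⟨hx.symm, ha⟩
      · rw [Function.update_of_ne fun h' => hb (N.rev_injective h')] at hx
        exact h.heard_eq b x hx }

theorem level_pos (h : G.IsTree r l) {a : N.Arc} (ha : a ∈ G.up) : 1 ≤ G.level a.1 := by
  have := h.up_level a ha
  omega

theorem path_up_ne (h : G.IsTree r l) {a : N.Arc} (ha : a ∈ G.up) : G.path a.1 ≠ [] := by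
  rw [h.up_path a ha]
  exact List.cons_ne_nil _ _

theorem link_eq_none (h : G.IsTree r l) {a : N.Arc} (ha : G.path a.1 = []) : G.link a = none := by
  rw [Option.eq_none_iff_forall_ne_some]
  intro i hi
  rcases (h.link_iff a i).1 hi with ⟨h1, -⟩ | ⟨h1, -⟩
  · exact h.path_up_ne h1 ha
  · have := h.up_head _ h1
    rw [N.rev_rev] at this
    exact this ha

/-- The tail of `a` joins the tree, and the head of `a` takes note of it. -/
theorem join (h : G.IsTree r l) {a : N.Arc} (ha : G.path a.1 = []) (hb : G.path (N.rev a).1 ≠ [])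
    (hl : G.level (N.rev a).1 < l) : ((G.join a l).attach (N.rev a) l).IsTree r l := by
  have hne : (N.rev a).1 ≠ a.1 := N.rev_fst_ne a
  have hpath : ∀ v, v ≠ a.1 → ((G.join a l).attach (N.rev a) l).path v = G.path v :=
    fun v hv => Function.update_of_ne hv _ _
  have hlevel : ∀ v, v ≠ a.1 → ((G.join a l).attach (N.rev a) l).level v = G.level v :=
    fun v hv => Function.update_of_ne hv _ _
  have hpa : ((G.join a l).attach (N.rev a) l).path a.1 = ((a.1 : ℕ) + 1) :: G.path (N.rev a).1 :=
    Function.update_self _ _ _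
  have hla : ((G.join a l).attach (N.rev a) l).level a.1 = l := Function.update_self _ _ _
  have hne_of : ∀ v, G.path v ≠ [] → v ≠ a.1 := fun v hv h' => hv (h' ▸ ha)
  have hup1 : ∀ b ∈ G.up, b.1 ≠ a.1 := fun b hb => hne_of _ (h.path_up_ne hb)
  have hup2 : ∀ b ∈ G.up, (N.rev b).1 ≠ a.1 := fun b hb => hne_of _ (h.up_head b hb)
  have hr : r ≠ a.1 := hne_of r (by rw [h.root_path]; exact List.cons_ne_nil _ _)
  refine ⟨?_, ?_, ?_, ?_, ?_, ?_, ?_, ?_, ?_, ?_, ?_, ?_, ?_⟩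
  · rw [hpath r hr, h.root_path]
  · rw [hlevel r hr, h.root_level]
  · intro v hv
    by_cases hva : v = a.1
    · rw [hva, hla]
    · rw [hlevel v hva]
      rw [hpath v hva] at hv
      exact h.level_le v hv
  · rintro b (rfl | hb') c (rfl | hc) hbc
    · rfl
    · exact absurd hbc.symm (hup1 c hc)
    · exact absurd hbc (hup1 b hb')
    · exact h.up_inj b hb' c hc hbc
  · rintro b (rfl | hb)
    · rw [hpa, hpath _ hne]
    · rw [hpath _ (hup1 b hb), hpath _ (hup2 b hb), h.up_path b hb]
  · rintro b (rfl | hb')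
    · rwa [hpath _ hne]
    · rw [hpath _ (hup2 b hb')]
      exact h.up_head b hb'
  · rintro b (rfl | hb)
    · rwa [hla, hlevel _ hne]
    · rw [hlevel _ (hup1 b hb), hlevel _ (hup2 b hb)]
      exact h.up_level b hb
  · rintro b (rfl | hb)
    · exact hr.symm
    · exact h.up_ne b hb
  · intro v hv
    by_cases hva : v = a.1
    · exact Or.inr ⟨a, Or.inl rfl, hva.symm⟩
    · rw [hpath v hva] at hv
      exact (h.exists_up v hv).imp id fun ⟨b, hb, hbv⟩ => ⟨b, Or.inr hb, hbv⟩
  · intro b i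
    have hlink : ((G.join a l).attach (N.rev a) l).link b =
        Function.update (Function.update G.link a (some l)) (N.rev a) (some l) b := rfl
    have hmem : ∀ c, c ∈ ((G.join a l).attach (N.rev a) l).up ↔ c = a ∨ c ∈ G.up := fun c => Iff.rfl
    have hra : N.rev a ∉ G.up := fun h' => hup2 _ h' (by rw [N.rev_rev])
    have haup : a ∉ G.up := fun h' => hup1 _ h' rfl
    rw [hlink, hmem, hmem]
    by_cases hb1 : b = N.rev a
    · subst hb1
      rw [Function.update_self, N.rev_rev, hla, Option.some_inj]
      have : N.rev a ≠ a := N.rev_ne a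
      tauto
    · rw [Function.update_of_ne hb1]
      by_cases hb2 : b = a
      · subst hb2
        rw [Function.update_self, hla, Option.some_inj]
        have : N.rev b ≠ b := N.rev_ne b
        tauto
      · rw [Function.update_of_ne hb2, h.link_iff]
        have hb3 : N.rev b ≠ a := fun h' => hb1 (N.rev_eq_iff.1 h')
        constructor
        · rintro (⟨h1, h2⟩ | ⟨h1, h2⟩)
          · exact Or.inl ⟨Or.inr h1, by rwa [hlevel _ (hup1 b h1)]⟩
          · exact Or.inr ⟨Or.inr h1, by rwa [hlevel _ (hup1 _ h1)]⟩
        · rintro (⟨h1, h2⟩ | ⟨h1, h2⟩)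
          · have h1 := h1.resolve_left hb2
            exact Or.inl ⟨h1, by rwa [hlevel _ (hup1 b h1)] at h2⟩
          · have h1 := h1.resolve_left hb3
            exact Or.inr ⟨h1, by rwa [hlevel _ (hup1 _ h1)] at h2⟩
  -- Recorded information never becomes stale: it comes only from nodes already in the tree, and a
  -- join changes the path of a node outside it.
  · intro b x hx
    obtain ⟨h1, h2⟩ := h.heard_eq b x hx
    rw [hpath _ (hne_of _ h2)]
    refine ⟨?_, h2⟩
    rw [h1, info, info, hpath _ (hne_of _ h2)]
  · intro v
    by_cases hva : v = a.1
    · rw [hva, hpa, hla, List.length_cons]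
      have := h.length_path (N.rev a).1
      omega
    · rw [hpath v hva, hlevel v hva]
      exact h.length_path v
  · intro v x hx
    by_cases hva : v = a.1
    · rw [hva, hpa] at hx
      rcases List.mem_cons.1 hx with rfl | hx
      · exact ⟨a.1, rfl⟩
      · exact h.mem_path _ x hx
    · rw [hpath v hva] at hx
      exact h.mem_path v x hx

/-- The part of the tree up to the level `j`. -/
def subtree (h : G.IsTree r l) (j : ℕ) : N.RootedSubtree r where
  up := {a | a ∈ G.up ∧ G.level a.1 ≤ j}
  level := G.level
  up_inj a ha b hb hab := h.up_inj a ha.1 b hb.1 hab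
  level_lt a ha := h.up_level a ha.1
  ne_root a ha := h.up_ne a ha.1
  head_mem a ha := by
    refine (h.exists_up _ (h.up_head a ha.1)).imp id ?_
    rintro ⟨b, hb, hba⟩
    refine ⟨b, ⟨hb, ?_⟩, hba⟩
    rw [hba]
    exact (h.up_level a ha.1).le.trans ha.2

theorem mem_nodes_subtree (h : G.IsTree r l) {j : ℕ} {v : Fin n} :
    v ∈ (h.subtree j).nodes ↔ G.path v ≠ [] ∧ G.level v ≤ j := by
  constructor
  · rintro (rfl | ⟨a, ha, rfl⟩)
    · rw [h.root_path, h.root_level]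
      exact ⟨List.cons_ne_nil _ _, Nat.zero_le _⟩
    · exact ⟨h.path_up_ne ha.1, ha.2⟩
  · rintro ⟨hv, hj⟩
    rcases h.exists_up v hv with h1 | ⟨a, ha, rfl⟩
    · exact Or.inl h1
    · exact Or.inr ⟨a, ⟨ha, hj⟩, rfl⟩

theorem mem_arcs_subtree (h : G.IsTree r l) {j : ℕ} {a : N.Arc} :
    a ∈ (h.subtree j).arcs ↔ ∃ i ≤ j, G.link a = some i := by
  constructor
  · rintro (ha | ha)
    · exact ⟨_, ha.2, (h.link_iff _ _).2 (Or.inl ⟨ha.1, rfl⟩)⟩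
    · exact ⟨_, ha.2, (h.link_iff _ _).2 (Or.inr ⟨ha.1, rfl⟩)⟩
  · rintro ⟨i, hi, ha⟩
    rcases (h.link_iff _ _).1 ha with ⟨h1, rfl⟩ | ⟨h1, rfl⟩
    · exact Or.inl ⟨h1, hi⟩
    · exact Or.inr ⟨h1, hi⟩

/-- Along an upward arc the stored path grows by exactly the new node, so the lists encode ancestry;
the induction follows the levels. -/
theorem mem_path_iff (h : G.IsTree r l) {j : ℕ} {w x : Fin n} (hw : w ∈ (h.subtree j).nodes) :
    ((x : ℕ) + 1) ∈ G.path w ↔ (h.subtree j).Below x w := by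
  induction hl : G.level w using Nat.strong_induction_on generalizing w with
  | _ m ih =>
    subst hl
    rw [Network.RootedSubtree.below_iff]
    rcases hw with rfl | ⟨a, ha, rfl⟩
    · rw [h.root_path, List.mem_singleton]
      constructor
      · exact fun h' => Or.inl (Fin.ext (by omega))
      · rintro (rfl | ⟨a, ha, har, -⟩)
        · rfl
        · exact absurd har (h.up_ne a ha.1)
    · rw [h.up_path a ha.1, List.mem_cons, ih _ (h.up_level a ha.1)
        ((h.subtree j).head_mem a ha) rfl]
      constructor
      · rintro (h' | h')
        · exact Or.inl (Fin.ext (by omega))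
        · exact Or.inr ⟨a, ha, rfl, h'⟩
      · rintro (rfl | ⟨b, hb, hba, h'⟩)
        · exact Or.inl rfl
        · rw [h.up_inj b hb.1 a ha.1 hba] at h'
          exact Or.inr h'

/-- All paths end in the root; hence the three paths of a bag can share that entry, which saves the
two places needed for width 3k. -/
theorem getLast_path (h : G.IsTree r l) {v : Fin n} (hv : G.path v ≠ []) :
    ∃ m : List ℕ, G.path v = m ++ [(r : ℕ) + 1] := by
  induction hl : G.level v using Nat.strong_induction_on generalizing v with
  | _ i ih =>
    subst hl
    rcases h.exists_up v hv with rfl | ⟨a, ha, rfl⟩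
    · exact ⟨[], h.root_path⟩
    · obtain ⟨m, hm⟩ := ih _ (h.up_level a ha) (h.up_head a ha) rfl
      exact ⟨((a.1 : ℕ) + 1) :: m, by rw [h.up_path a ha, hm, List.cons_append]⟩

end IsTree

end GlobalState

/-! ### The walk around a tree, step by step -/

namespace Equiv.Perm

variable {α : Type*} {σ : Equiv.Perm α} {a b : α}

theorem SameCycle.exists_pow_lt [Finite α] (h : σ.SameCycle a b) {i : ℕ}
    (hi : (σ ^ (i + 1)) a = a) : ∃ m < i + 1, (σ ^ m) a = b := by
  obtain ⟨m, -, -, rfl⟩ := h.exists_pow_eq''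
  refine ⟨m % (i + 1), Nat.mod_lt _ i.succ_pos, ?_⟩
  conv_rhs => rw [← Nat.mod_add_div m (i + 1), pow_add, mul_apply, pow_mul]
  rw [Function.IsFixedPt.perm_pow hi]

theorem pow_injOn_of_ne [Finite α] {i : ℕ} (h : ∀ m, 0 < m → m ≤ i → (σ ^ m) a ≠ a) {x y : ℕ}
    (hx : x ≤ i) (hy : y ≤ i) (hxy : (σ ^ x) a = (σ ^ y) a) : x = y := by
  rw [← stepsTo_pow fun m hm hmx => h m hm (hmx.trans hx), hxy,
    stepsTo_pow fun m hm hmy => h m hm (hmy.trans hy)]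

end Equiv.Perm

namespace Network.RootedSubtree

variable {n : ℕ} {N : Network n} {r : Fin n} (T : N.RootedSubtree r)

/-- The walk around the tree. -/
noncomputable def walk : Equiv.Perm N.Arc := N.contour T.arcs T.rev_mem_arcs

theorem walk_of_mem {a : N.Arc} (h : a ∈ T.arcs) : T.walk a = N.turn (N.rev a) := contour_of_mem h

theorem walk_of_notMem {a : N.Arc} (h : a ∉ T.arcs) : T.walk a = N.turn a := contour_of_notMem h

theorem fst_walk_mem {a : N.Arc} (ha : a.1 ∈ T.nodes) : (T.walk a).1 ∈ T.nodes := by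
  by_cases h : a ∈ T.arcs
  · rw [T.walk_of_mem h, N.turn_fst]
    rcases h with h | h
    · exact T.head_mem a h
    · exact Or.inr ⟨_, h, rfl⟩
  · rwa [T.walk_of_notMem h, N.turn_fst]

theorem fst_walk_pow_mem {a : N.Arc} (ha : a.1 = r) (m : ℕ) : ((T.walk ^ m) a).1 ∈ T.nodes := by
  induction m with
  | zero => exact Or.inl ha
  | succ m ih =>
    rw [pow_succ', Equiv.Perm.mul_apply]
    exact T.fst_walk_mem ih

/-- This recasts closing arcs as something a node can observe: the opposite arc has occurred at an
earlier step. -/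
theorem walk_pow_mem_closing {a₀ : N.Arc} (hT : ∀ v, v ∈ T.nodes) {i : ℕ}
    (hi : ∀ m, 0 < m → m ≤ i → (T.walk ^ m) a₀ ≠ a₀) (ha : (T.walk ^ i) a₀ ∉ T.arcs) :
    (T.walk ^ i) a₀ ∈ T.closing a₀ ↔ ∃ m < i, (T.walk ^ m) a₀ = N.rev ((T.walk ^ i) a₀) := by
  have ht : T.time a₀ ((T.walk ^ i) a₀) = i := Equiv.Perm.stepsTo_pow hi
  constructor
  · rintro ⟨-, h⟩
    rw [ht] at h
    exact ⟨_, h, (T.sameCycle_contour (hT _) (hT _)).pow_stepsTo⟩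
  · rintro ⟨m, hm, h⟩
    refine ⟨ha, ?_⟩
    rw [ht]
    exact lt_of_le_of_lt (Equiv.Perm.stepsTo_le h) hm

theorem apex_walk_of_mem {a₀ a : N.Arc} (hT : ∀ v, v ∈ T.nodes) (hN : N.IsPlanarEmbedding)
    (ha : a ∈ T.arcs) : T.apex a₀ (T.walk a) = T.apex a₀ a := by
  rw [T.walk_of_mem ha, ← facePerm_apply, T.apex_facePerm hT hN]

/-- Turning past a link outside the tree means crossing it: the next arc of the walk follows the
reverse arc on its face. -/
theorem apex_walk_of_notMem {a₀ a : N.Arc} (hT : ∀ v, v ∈ T.nodes) (hN : N.IsPlanarEmbedding)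
    (ha : a ∉ T.arcs) : T.apex a₀ (T.walk a) = T.apex a₀ (N.rev a) := by
  have h : T.walk a = N.facePerm (N.rev a) := by
    rw [T.walk_of_notMem ha, facePerm_apply, N.rev_rev]
  rw [h, T.apex_facePerm hT hN]

end Network.RootedSubtree

/-- The lists of identifiers that may occur in messages. -/
def IsShort (n k : ℕ) (z : List ℕ) : Prop := z.length ≤ k + 2 ∧ ∀ x ∈ z, x ≤ n

/-! ### The invariant of a round -/

namespace GlobalState

variable {n : ℕ} {N : Network n}

/-- The global state `G` in the round `j` when the walk around the tree `T` up to the level `j` that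
starts with `a₀` has made `i` steps. -/
structure InRound (G : GlobalState N) (k : ℕ) {r : Fin n} (a₀ : N.Arc) (j : ℕ)
    (T : N.RootedSubtree r) (i : ℕ) : Prop where
  tree : G.IsTree r (j + 1)
  mem_nodes : ∀ v, v ∈ T.nodes ↔ G.path v ≠ [] ∧ G.level v ≤ j
  mem_arcs : ∀ a, a ∈ T.arcs ↔ ∃ l ≤ j, G.link a = some l
  ball : ∀ v (w : N.graph.Walk v r), w.length ≤ j → v ∈ T.nodes
  heard : ∀ m < i, G.heard (N.rev ((T.walk ^ m) a₀)) ≠ none ∧ G.path (N.rev ((T.walk ^ m) a₀)).1 ≠ []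
  root_heard : 1 ≤ j ∨ 1 ≤ i → G.heard a₀ ≠ none
  crossed_none : ∀ j' > j, ∀ a, G.crossed j' a = none
  crossed_short : ∀ j' a z, G.crossed j' a = some z → IsShort n k z

theorem heard_hear_self (G : GlobalState N) (a : N.Arc) :
    (G.hear a).heard (N.rev a) = some (G.info a) :=
  Function.update_self _ _ _

theorem heard_hear_ne_none {G : GlobalState N} {a b : N.Arc} (h : G.heard b ≠ none) :
    (G.hear a).heard b ≠ none := by
  change Function.update G.heard (N.rev a) (some (G.info a)) b ≠ none
  by_cases hb : b = N.rev a
  · subst hb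
    simp
  · rwa [Function.update_of_ne hb]

namespace InRound

variable {G : GlobalState N} {k : ℕ} {r : Fin n} {a₀ : N.Arc} {j : ℕ} {T : N.RootedSubtree r} {i : ℕ}

theorem visit (h : G.InRound k a₀ j T i) (a : N.Arc) (z : List ℕ) :
    (G.visit j a z).InRound k a₀ j T i :=
  { h with tree := h.tree.visit j a z }

theorem hear (h : G.InRound k a₀ j T i) {a : N.Arc} (ha : G.path a.1 ≠ []) :
    (G.hear a).InRound k a₀ j T i :=
  { h with
    tree := h.tree.hear ha
    heard := fun m hm => ⟨heard_hear_ne_none (h.heard m hm).1, (h.heard m hm).2⟩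
    root_heard := fun h' => heard_hear_ne_none (h.root_heard h') }

theorem cross (h : G.InRound k a₀ j T i) (a : N.Arc) {z : List ℕ} (hz : IsShort n k z) :
    (G.cross j a z).InRound k a₀ j T i :=
  { h with
    tree := h.tree.cross j a z
    crossed_none := by
      intro j' hj' b
      change Function.update G.crossed j _ j' b = none
      rw [Function.update_of_ne hj'.ne']
      exact h.crossed_none j' hj' b
    crossed_short := by
      intro j' b y hy
      change Function.update G.crossed j (Function.update (G.crossed j) a (some z)) j' b = some y at hy
      by_cases hj' : j' = j
      · subst hj'
        rw [Function.update_self] at hy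
        by_cases hb : b = a
        · subst hb
          rw [Function.update_self, Option.some_inj] at hy
          exact hy ▸ hz
        · rw [Function.update_of_ne hb] at hy
          exact h.crossed_short _ b y hy
      · rw [Function.update_of_ne hj'] at hy
        exact h.crossed_short j' b y hy }

/-- The new link gets level j + 1, so neither the nodes nor the arcs of the tree of round j change,
and the walk in progress is not disturbed. -/
theorem join (h : G.InRound k a₀ j T i) {a : N.Arc} (ha : a.1 ∈ T.nodes)
    (hb : G.path (N.rev a).1 = []) :
    ((G.join (N.rev a) (j + 1)).attach a (j + 1)).InRound k a₀ j T i := by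
  have ha' := (h.mem_nodes _).1 ha
  have htree : ((G.join (N.rev a) (j + 1)).attach a (j + 1)).IsTree r (j + 1) := by
    have h' := h.tree.join hb (by rw [N.rev_rev]; exact ha'.1)
      (by rw [N.rev_rev]; exact Nat.lt_succ_of_le ha'.2)
    rwa [N.rev_rev] at h'
  have hpath : ∀ v, G.path v ≠ [] → ((G.join (N.rev a) (j + 1)).attach a (j + 1)).path v ≠ [] := by
    intro v hv
    have hne : v ≠ (N.rev a).1 := fun h' => hv (h' ▸ hb)
    rwa [show ((G.join (N.rev a) (j + 1)).attach a (j + 1)).path v = G.path v from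
      Function.update_of_ne hne _ _]
  refine ⟨htree, ?_, ?_, h.ball, ?_, h.root_heard, h.crossed_none, h.crossed_short⟩
  · intro v
    rw [h.mem_nodes]
    by_cases hv : v = (N.rev a).1
    · subst hv
      rw [hb, show ((G.join (N.rev a) (j + 1)).attach a (j + 1)).level (N.rev a).1 = j + 1 from
        Function.update_self _ _ _]
      simp
    · rw [show ((G.join (N.rev a) (j + 1)).attach a (j + 1)).path v = G.path v from
        Function.update_of_ne hv _ _,
        show ((G.join (N.rev a) (j + 1)).attach a (j + 1)).level v = G.level v from
        Function.update_of_ne hv _ _]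
  · intro b
    rw [h.mem_arcs]
    have hlink : ((G.join (N.rev a) (j + 1)).attach a (j + 1)).link b =
      Function.update (Function.update G.link (N.rev a) (some (j + 1))) a (some (j + 1)) b := rfl
    have hnone : G.link (N.rev a) = none := h.tree.link_eq_none hb
    have hnone' : G.link a = none := by
      rw [Option.eq_none_iff_forall_ne_some] at hnone ⊢
      intro l hl
      refine hnone l ((h.tree.link_iff _ l).2 ?_)
      rw [N.rev_rev]
      exact ((h.tree.link_iff _ l).1 hl).symm
    rw [hlink]
    have hno : ¬ ∃ l ≤ j, some (j + 1) = some l := by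
      rintro ⟨l, hl, h'⟩
      rw [Option.some_inj] at h'
      omega
    by_cases h1 : b = a
    · subst h1
      rw [Function.update_self, hnone']
      simp only [hno, iff_false]
      simp
    · rw [Function.update_of_ne h1]
      by_cases h2 : b = N.rev a
      · subst h2
        rw [Function.update_self, hnone]
        simp only [hno, iff_false]
        simp
      · rw [Function.update_of_ne h2]
  · exact fun m hm => ⟨(h.heard m hm).1, hpath _ (h.heard m hm).2⟩

theorem succ (h : G.InRound k a₀ j T i) (h₁ : G.heard (N.rev ((T.walk ^ i) a₀)) ≠ none)
    (h₂ : G.path (N.rev ((T.walk ^ i) a₀)).1 ≠ []) (h₃ : G.heard a₀ ≠ none) :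
    G.InRound k a₀ j T (i + 1) :=
  { h with
    heard := by
      intro m hm
      rcases Nat.lt_succ_iff_lt_or_eq.1 hm with hm | rfl
      · exact h.heard m hm
      · exact ⟨h₁, h₂⟩
    root_heard := fun _ => h₃ }

theorem path_ne (h : G.InRound k a₀ j T i) (h₀ : a₀.1 = r) (m : ℕ) :
    G.path ((T.walk ^ m) a₀).1 ≠ [] :=
  ((h.mem_nodes _).1 (T.fst_walk_pow_mem h₀ m)).1

theorem isShort_path (h : G.InRound k a₀ j T i) (hj : j ≤ k) (v : Fin n) :
    IsShort n k (G.path v) := by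
  refine ⟨?_, fun x hx => ?_⟩
  swap
  · obtain ⟨u, rfl⟩ := h.tree.mem_path v x hx
    exact u.2
  by_cases hv : G.path v = []
  · rw [hv]
    exact Nat.zero_le _
  · have h1 := h.tree.length_path v
    have h2 := h.tree.level_le v hv
    omega

/-- The token moves along a link of the tree. -/
theorem move (h : G.InRound k a₀ j T i) (h₀ : a₀.1 = r) (ha : (T.walk ^ i) a₀ ∈ T.arcs) (z : List ℕ) :
    ((G.visit j ((T.walk ^ i) a₀) z).hear ((T.walk ^ i) a₀)).InRound k a₀ j T (i + 1) := by
  have hnode := T.fst_walk_mem (T.fst_walk_pow_mem h₀ i)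
  rw [T.walk_of_mem ha, N.turn_fst, h.mem_nodes] at hnode
  -- Levels of tree links are at least 1, so no `move` occurs in round 0; the root has therefore
  -- already heard over its first port.
  have hj : 1 ≤ j := by
    obtain ⟨l, hl, hla⟩ := (h.mem_arcs _).1 ha
    rcases (h.tree.link_iff _ _).1 hla with ⟨h1, h2⟩ | ⟨h1, h2⟩ <;>
      · have := h.tree.level_pos h1
        omega
  refine ((h.visit _ z).hear (h.path_ne h₀ i)).succ ?_ hnode.1
    (heard_hear_ne_none (h.root_heard (Or.inl hj)))
  rw [heard_hear_self]
  exact Option.some_ne_none _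

theorem root_heard_of_hear (h : G.InRound k a₀ j T i) :
    (G.hear (N.rev ((T.walk ^ i) a₀))).heard a₀ ≠ none := by
  rcases Nat.eq_zero_or_pos i with rfl | hi
  · have h' := G.heard_hear_self (N.rev a₀)
    rw [N.rev_rev] at h'
    rw [pow_zero, Equiv.Perm.one_apply, h']
    exact Option.some_ne_none _
  · exact heard_hear_ne_none (h.root_heard (Or.inr hi))

/-- The token probes a link of which the other end is in the tree. -/
theorem probe_reject (h : G.InRound k a₀ j T i) (h₀ : a₀.1 = r) {a : N.Arc}
    (ha : (T.walk ^ i) a₀ = a) (hb : G.path (N.rev a).1 ≠ []) {z : List ℕ} (hz : IsShort n k z) :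
    ((((G.visit j a z).hear a).cross j (N.rev a) z).hear (N.rev a)).InRound k a₀ j T (i + 1) := by
  have hpa : G.path a.1 ≠ [] := ha ▸ h.path_ne h₀ i
  have h1 := ((h.visit a z).hear hpa).cross (N.rev a) hz
  refine (h1.hear hb).succ ?_ ?_ ?_
  · rw [ha]
    refine heard_hear_ne_none ?_
    change ((G.visit j a z).hear a).heard (N.rev a) ≠ none
    rw [heard_hear_self]
    exact Option.some_ne_none _
  · rwa [ha]
  · rw [← ha] at h1 ⊢
    exact h1.root_heard_of_hear

/-- The token probes a link of which the other end then joins the tree. -/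
theorem probe_accept (h : G.InRound k a₀ j T i) (h₀ : a₀.1 = r) {a : N.Arc}
    (ha : (T.walk ^ i) a₀ = a) (hb : G.path (N.rev a).1 = []) {z : List ℕ} (hz : IsShort n k z) :
    ((((((G.visit j a z).hear a).cross j (N.rev a) z).join (N.rev a) (j + 1)).attach a (j + 1)).hear
      (N.rev a)).InRound k a₀ j T (i + 1) := by
  have hpa : G.path a.1 ≠ [] := ha ▸ h.path_ne h₀ i
  have hnode : a.1 ∈ T.nodes := ha ▸ T.fst_walk_pow_mem h₀ i
  have h1 := (((h.visit a z).hear hpa).cross (N.rev a) hz).join hnode hb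
  have hb' : (((((G.visit j a z).hear a).cross j (N.rev a) z).join (N.rev a) (j + 1)).attach a
      (j + 1)).path (N.rev a).1 ≠ [] := by
    rw [show (((((G.visit j a z).hear a).cross j (N.rev a) z).join (N.rev a) (j + 1)).attach a
      (j + 1)).path (N.rev a).1 = _ from Function.update_self _ _ _]
    exact List.cons_ne_nil _ _
  refine (h1.hear hb').succ ?_ ?_ ?_
  · rw [ha]
    refine heard_hear_ne_none ?_
    change ((G.visit j a z).hear a).heard (N.rev a) ≠ none
    rw [heard_hear_self]
    exact Option.some_ne_none _
  · rw [ha]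
    exact hb'
  · rw [← ha] at h1 ⊢
    exact h1.root_heard_of_hear

/-- The state at the end of a round is one for the beginning of the next round. -/
theorem next (h : G.InRound k a₀ j T (i + 1)) (h₀ : a₀.1 = r) (hi : (T.walk ^ (i + 1)) a₀ = a₀) :
    G.InRound k a₀ (j + 1) (h.tree.subtree (j + 1)) 0 where
  tree := h.tree.mono (Nat.le_succ _)
  mem_nodes v := h.tree.mem_nodes_subtree
  mem_arcs a := h.tree.mem_arcs_subtree
  ball v w hw := by
    rw [h.tree.mem_nodes_subtree]
    cases w with
    | nil =>
      rw [h.tree.root_path, h.tree.root_level]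
      exact ⟨List.cons_ne_nil _ _, Nat.zero_le _⟩
    -- The next node towards `r` is within distance j, hence in `T`. The completed walk has passed
    -- its arc to the given node, which has thereby entered the tree if it was not there before.
    | cons hadj w =>
      rw [SimpleGraph.Walk.length_cons] at hw
      have hu := h.ball _ w (by omega)
      obtain ⟨a, rfl, rfl⟩ := N.exists_arc hadj.symm
      have hcyc : T.walk.SameCycle a₀ a :=
        T.sameCycle_contour (Or.inl h₀) hu
      obtain ⟨m, hm, rfl⟩ := hcyc.exists_pow_lt hi
      have h1 := (h.heard m hm).2
      exact ⟨h1, h.tree.level_le _ h1⟩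
  heard m hm := absurd hm (Nat.not_lt_zero m)
  root_heard _ := h.root_heard (Or.inr (Nat.succ_pos i))
  crossed_none j' hj' := h.crossed_none j' (by omega)
  crossed_short := h.crossed_short

end InRound

/-! ### The invariant of the last round -/

/-- The information collected in the last round, when the walk around the spanning tree `T` that
starts with `a₀` has made `i` steps. -/
structure InLastRound (G : GlobalState N) (k : ℕ) {r : Fin n} (a₀ : N.Arc) (T : N.RootedSubtree r)
    (i : ℕ) : Prop where
  mem_path : ∀ x w : Fin n, ((x : ℕ) + 1) ∈ G.path w ↔ T.Below x w
  spanning : ∀ v, v ∈ T.nodes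
  crossed_some : ∀ m < i, (T.walk ^ m) a₀ ∉ T.arcs →
    G.crossed k (N.rev ((T.walk ^ m) a₀)) = some (G.path (T.apex a₀ ((T.walk ^ m) a₀)))
  crossed_none : ∀ a, (∀ m < i, (T.walk ^ m) a₀ = N.rev a → N.rev a ∈ T.arcs) → G.crossed k a = none
  apex : ∀ m < i, G.apex ((T.walk ^ m) a₀) = G.path (T.apex a₀ ((T.walk ^ m) a₀))
  exit : ∀ m < i, (G.exit ((T.walk ^ m) a₀) = true ↔ (T.walk ^ m) a₀ ∈ T.closing a₀)

namespace InLastRound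

variable {G : GlobalState N} {k : ℕ} {r : Fin n} {a₀ : N.Arc} {T : N.RootedSubtree r} {i : ℕ}

theorem crossed_isSome_iff (h : G.InLastRound k a₀ T i)
    (hi : ∀ m, 0 < m → m ≤ i → (T.walk ^ m) a₀ ≠ a₀) :
    (G.crossed k ((T.walk ^ i) a₀)).isSome = true ↔ (T.walk ^ i) a₀ ∈ T.closing a₀ := by
  by_cases ha : (T.walk ^ i) a₀ ∈ T.arcs
  · rw [h.crossed_none _ fun m _ _ => (T.rev_mem_arcs _).2 ha]
    exact iff_of_false (by simp) fun h' => h'.1 ha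
  · rw [T.walk_pow_mem_closing h.spanning hi ha]
    constructor
    · intro hs
      by_contra hcon
      push Not at hcon
      rw [h.crossed_none _ fun m hm hm' => absurd hm' (hcon m hm)] at hs
      simp at hs
    · rintro ⟨m, hm, hm'⟩
      have h1 := h.crossed_some m hm (by rw [hm', T.rev_mem_arcs]; exact ha)
      rw [hm', N.rev_rev] at h1
      rw [h1]
      rfl

theorem visit (h : G.InLastRound k a₀ T i) (hi : ∀ m, 0 < m → m ≤ i → (T.walk ^ m) a₀ ≠ a₀) :
    (G.visit k ((T.walk ^ i) a₀) (G.path (T.apex a₀ ((T.walk ^ i) a₀)))).InLastRound k a₀ T i ∧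
    (G.visit k ((T.walk ^ i) a₀) (G.path (T.apex a₀ ((T.walk ^ i) a₀)))).apex ((T.walk ^ i) a₀) =
      G.path (T.apex a₀ ((T.walk ^ i) a₀)) ∧
    ((G.visit k ((T.walk ^ i) a₀) (G.path (T.apex a₀ ((T.walk ^ i) a₀)))).exit
      ((T.walk ^ i) a₀) = true ↔ (T.walk ^ i) a₀ ∈ T.closing a₀) := by
  have hne : ∀ m < i, (T.walk ^ m) a₀ ≠ (T.walk ^ i) a₀ := fun m hm h' =>
    hm.ne (Equiv.Perm.pow_injOn_of_ne hi hm.le le_rfl h')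
  refine ⟨{ h with apex := ?_, exit := ?_ }, Function.update_self _ _ _, ?_⟩
  · intro m hm
    exact (Function.update_of_ne (hne m hm) _ _).trans (h.apex m hm)
  · intro m hm
    refine Iff.trans (Eq.congr_left ?_) (h.exit m hm)
    exact Function.update_of_ne (hne m hm) _ _
  · refine Iff.trans (Eq.congr_left ?_) (h.crossed_isSome_iff hi)
    exact Function.update_self _ _ _

theorem hear (h : G.InLastRound k a₀ T i) (a : N.Arc) : (G.hear a).InLastRound k a₀ T i :=
  { h with }

theorem move (h : G.InLastRound k a₀ T i) (hi : ∀ m, 0 < m → m ≤ i → (T.walk ^ m) a₀ ≠ a₀)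
    {a : N.Arc} (ha : (T.walk ^ i) a₀ = a) (hat : a ∈ T.arcs) {z : List ℕ}
    (hz : z = G.path (T.apex a₀ a)) :
    ((G.visit k a z).hear a).InLastRound k a₀ T (i + 1) := by
  subst ha hz
  obtain ⟨h1, h2, h3⟩ := h.visit hi
  refine InLastRound.hear ⟨h1.mem_path, h1.spanning, ?_, ?_, ?_, ?_⟩ _
  · intro m hm hmt
    rcases Nat.lt_succ_iff_lt_or_eq.1 hm with hm | rfl
    · exact h1.crossed_some m hm hmt
    · exact absurd hat hmt
  · exact fun b hb => h1.crossed_none b fun m hm => hb m (hm.trans (Nat.lt_succ_self i))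
  · intro m hm
    rcases Nat.lt_succ_iff_lt_or_eq.1 hm with hm | rfl
    · exact h1.apex m hm
    · exact h2
  · intro m hm
    rcases Nat.lt_succ_iff_lt_or_eq.1 hm with hm | rfl
    · exact h1.exit m hm
    · exact h3

theorem probe (h : G.InLastRound k a₀ T i) (hi : ∀ m, 0 < m → m ≤ i → (T.walk ^ m) a₀ ≠ a₀)
    {a : N.Arc} (ha : (T.walk ^ i) a₀ = a) (hat : a ∉ T.arcs) {z : List ℕ}
    (hz : z = G.path (T.apex a₀ a)) :
    ((((G.visit k a z).hear a).cross k (N.rev a) z).hear (N.rev a)).InLastRound k a₀ T (i + 1) := by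
  subst ha hz
  obtain ⟨h1, h2, h3⟩ := h.visit hi
  have hcr : ∀ (G' : GlobalState N) (b : N.Arc) (y : List ℕ) (d : N.Arc),
      (G'.cross k b y).crossed k d = Function.update (G'.crossed k) b (some y) d := by
    intro G' b y d
    change Function.update G'.crossed k _ k d = _
    rw [Function.update_self]
  refine InLastRound.hear (G := ((G.visit k ((T.walk ^ i) a₀)
    (G.path (T.apex a₀ ((T.walk ^ i) a₀)))).hear ((T.walk ^ i) a₀)).cross k
    (N.rev ((T.walk ^ i) a₀)) (G.path (T.apex a₀ ((T.walk ^ i) a₀))))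
    ⟨h1.mem_path, h1.spanning, ?_, ?_, ?_, ?_⟩ _
  · intro m hm hmt
    rw [hcr]
    rcases Nat.lt_succ_iff_lt_or_eq.1 hm with hm | rfl
    · rw [Function.update_of_ne]
      · exact h1.crossed_some m hm hmt
      · exact fun h' => hm.ne (Equiv.Perm.pow_injOn_of_ne hi hm.le le_rfl (N.rev_injective h'))
    · exact Function.update_self _ _ _
  · intro b hb
    rw [hcr, Function.update_of_ne]
    · exact h1.crossed_none b fun m hm => hb m (hm.trans (Nat.lt_succ_self i))
    · rintro rfl
      have := hb i (Nat.lt_succ_self i) (N.rev_rev _).symm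
      rw [N.rev_rev] at this
      exact hat this
  · intro m hm
    rcases Nat.lt_succ_iff_lt_or_eq.1 hm with hm | rfl
    · exact h1.apex m hm
    · exact h2
  · intro m hm
    rcases Nat.lt_succ_iff_lt_or_eq.1 hm with hm | rfl
    · exact h1.exit m hm
    · exact h3

/-- If the arc is closing, the face entered is the one from which the link was first probed, and
that probe left the path of its apex. Otherwise no mark is found, the reverse arc is the exit of the
face entered, and the apex is the current node itself. -/
theorem carry_after_probe (h : G.InLastRound k a₀ T (i + 1)) (hN : N.IsPlanarEmbedding)
    (hi : ∀ m, 0 < m → m ≤ i → (T.walk ^ m) a₀ ≠ a₀) {a : N.Arc} (ha : (T.walk ^ i) a₀ = a)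
    (hat : a ∉ T.arcs) :
    (G.crossed k a).getD (G.path a.1) = G.path (T.apex a₀ (T.walk a)) := by
  subst ha
  rw [T.apex_walk_of_notMem h.spanning hN hat]
  have hcl := T.walk_pow_mem_closing h.spanning hi hat
  by_cases hc : (T.walk ^ i) a₀ ∈ T.closing a₀
  · obtain ⟨m, hm, hm'⟩ := hcl.1 hc
    have h1 := h.crossed_some m (hm.trans (Nat.lt_succ_self i)) (by rwa [hm', T.rev_mem_arcs])
    rw [hm', N.rev_rev] at h1
    rw [h1, Option.getD_some]
  · have hrc : N.rev ((T.walk ^ i) a₀) ∈ T.closing a₀ :=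
      (T.mem_closing_or h.spanning hat).resolve_left hc
    rw [T.apex_of_mem_exits h.spanning hN (Or.inr hrc), N.rev_rev, h.crossed_none, Option.getD_none]
    intro m hm hm'
    rcases Nat.lt_succ_iff_lt_or_eq.1 hm with hm | rfl
    · exact absurd (hcl.2 ⟨m, hm, hm'⟩) hc
    · exact absurd hm'.symm (N.rev_ne _)

end InLastRound

theorem InRound.inLastRound {G : GlobalState N} {k : ℕ} {r : Fin n} {a₀ : N.Arc} {j i : ℕ}
    {T : N.RootedSubtree r} (h : G.InRound k a₀ j T (i + 1)) (h₀ : a₀.1 = r)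
    (hi : (T.walk ^ (i + 1)) a₀ = a₀) (hk : ∀ v, ∃ w : N.graph.Walk v r, w.length ≤ j + 1) :
    G.InLastRound (j + 1) a₀ (h.tree.subtree (j + 1)) 0 where
  mem_path x w := by
    obtain ⟨p, hp⟩ := hk w
    exact h.tree.mem_path_iff ((h.next h₀ hi).ball w p hp)
  spanning v := by
    obtain ⟨p, hp⟩ := hk v
    exact (h.next h₀ hi).ball v p hp
  crossed_some m hm := absurd hm (Nat.not_lt_zero m)
  crossed_none a _ := h.crossed_none _ (Nat.lt_succ_self j) a
  apex m hm := absurd hm (Nat.not_lt_zero m)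
  exit m hm := absurd hm (Nat.not_lt_zero m)

end GlobalState

/-! ### Lengths and numbers of messages -/

/-- A bound on the number of bits of a message. -/
def maxBits (n k : ℕ) : ℕ := (2 * k + 9) * (2 * Nat.log 2 (n + k + 3) + 3)

/-- Five header numbers and two lists of at most k + 2 entries give 2k + 9 numbers; each is at most
n + k + 3, where the summand 3 also covers the code of the kind. -/
theorem Token.length_encode_le {n k : ℕ} (t : Token) (hr : t.round ≤ k) (hp : t.port ≤ n)
    (hq : t.prev ≤ n) (h₁ : IsShort n k t.path) (h₂ : IsShort n k t.carry) :
    t.encode.length ≤ maxBits n k := by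
  refine (length_encodeNats_le (M := n + k + 3) ?_).trans (Nat.mul_le_mul_right _ ?_)
  · have hκ : t.kind.toNat ≤ 3 := by cases t.kind <;> simp [Kind.toNat]
    have hl := h₁.1
    intro x hx
    simp only [List.mem_cons, List.mem_append] at hx
    rcases hx with rfl | rfl | rfl | rfl | rfl | hx | hx
    · omega
    · omega
    · omega
    · omega
    · omega
    · have := h₁.2 x hx
      omega
    · have := h₂.2 x hx
      omega
  · have := h₁.1
    have := h₂.1
    simp only [List.length_cons, List.length_append]
    omega

namespace Network

variable {n : ℕ} {N : Network n}

theorem deg_le (v : Fin n) : N.deg v ≤ n := by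
  have h := Fintype.card_le_of_injective (fun p => (N.port v p : Fin n))
    (Subtype.val_injective.comp (N.port v).injective)
  simpa using h

/-- The number of times that the link of `b` is met in the first `i` steps of a walk. -/
def hits (σ : Equiv.Perm N.Arc) (a₀ b : N.Arc) (i : ℕ) : ℕ :=
  ((Finset.range i).filter fun m => (σ ^ m) a₀ = b ∨ (σ ^ m) a₀ = N.rev b).card

theorem hits_succ (σ : Equiv.Perm N.Arc) (a₀ b : N.Arc) (i : ℕ) :
    hits σ a₀ b (i + 1) =
      hits σ a₀ b i + if (σ ^ i) a₀ = b ∨ (σ ^ i) a₀ = N.rev b then 1 else 0 := by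
  rw [hits, hits, Finset.range_add_one, Finset.filter_insert]
  split_ifs with h
  · rw [Finset.card_insert_of_notMem (by simp)]
  · rfl

/-- Before its return the walk repeats no arc, so each of the two arcs of the link is met at most
once. -/
theorem hits_le_two {σ : Equiv.Perm N.Arc} {a₀ : N.Arc} {i : ℕ}
    (h : ∀ m, 0 < m → m ≤ i → (σ ^ m) a₀ ≠ a₀) (b : N.Arc) : hits σ a₀ b (i + 1) ≤ 2 := by
  refine le_trans ?_ (Finset.card_le_two (a := b) (b := N.rev b))
  refine Finset.card_le_card_of_injOn (fun m => (σ ^ m) a₀) ?_ ?_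
  · intro m hm
    simpa using (Finset.mem_filter.1 hm).2
  · intro x hx y hy hxy
    have hx' := Finset.mem_range.1 (Finset.mem_filter.1 hx).1
    have hy' := Finset.mem_range.1 (Finset.mem_filter.1 hy).1
    exact Equiv.Perm.pow_injOn_of_ne h (by omega) (by omega) hxy

theorem lt_card_arc {σ : Equiv.Perm N.Arc} {a₀ : N.Arc} {i : ℕ}
    (h : ∀ m, 0 < m → m ≤ i → (σ ^ m) a₀ ≠ a₀) : i < Nat.card N.Arc := by
  have h1 := Finset.card_le_card_of_injOn (s := Finset.range (i + 1)) (t := Finset.univ)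
    (fun m => (σ ^ m) a₀) (fun _ _ => Finset.mem_coe.2 (Finset.mem_univ _)) (fun x hx y hy hxy => by
      have hx' := Finset.mem_range.1 hx
      have hy' := Finset.mem_range.1 hy
      exact Equiv.Perm.pow_injOn_of_ne h (by omega) (by omega) hxy)
  rw [Finset.card_range, Finset.card_univ, ← Nat.card_eq_fintype_card] at h1
  exact h1

end Network

namespace Config

variable {Out : LocalInput → Type} {A : DistAlgorithm Out} {n : ℕ} {N : Network n}

theorem linkCount_act_nil (c : Config A N) (v : Fin n) (t : ℝ) (s : A.State) (b : N.Arc) :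
    (c.act v t (s, [])).linkCount b = c.linkCount b := by
  simp [linkCount, act]

theorem linkCount_act_singleton (c : Config A N) (v : Fin n) (t : ℝ) (s : A.State) (p : Fin (N.deg v))
    (m : Message) (b : N.Arc) :
    (c.act v t (s, [(p, m)])).linkCount b = c.linkCount b +
      if (⟨v, p⟩ : N.Arc) = b ∨ (⟨v, p⟩ : N.Arc) = N.rev b then 1 else 0 := by
  simp only [linkCount, act, List.map_cons, List.map_nil, Multiset.countP_add,
    Multiset.coe_singleton]
  congr 1
  by_cases h : (⟨v, p⟩ : N.Arc) = b ∨ (⟨v, p⟩ : N.Arc) = N.rev b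
  · rw [if_pos h]
    exact Multiset.countP_eq_card.2 (by simpa using h)
  · rw [if_neg h]
    exact Multiset.countP_eq_zero.2 (by simpa using h)

end Config

namespace GlobalState

variable {n : ℕ} {N : Network n} (G : GlobalState N)

/-- A message sent along the arc `a`. -/
def token (κ : Kind) (j : ℕ) (a : N.Arc) (z : List ℕ) : Token :=
  ⟨κ, j, a.2, (N.turn a).2, G.path a.1, z⟩

theorem length_encode_token_le {k j : ℕ} (hj : j ≤ k) (κ : Kind) (a : N.Arc) {z : List ℕ}
    (h₁ : IsShort n k (G.path a.1)) (h₂ : IsShort n k z) :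
    (G.token κ j a z).encode.length ≤ maxBits n k :=
  Token.length_encode_le _ hj (a.2.2.le.trans (N.deg_le _)) ((N.turn a).2.2.le.trans (N.deg_le _))
    h₁ h₂

open Classical in
/-- The kind of message by which the token passes the arc `a` when it walks around `T`. -/
noncomputable def _root_.Network.RootedSubtree.kind {r : Fin n} (T : N.RootedSubtree r) (a : N.Arc) : Kind :=
  if a ∈ T.arcs then Kind.move else Kind.probe

theorem InRound.kind_eq {G : GlobalState N} {k : ℕ} {r : Fin n} {a₀ : N.Arc} {j : ℕ}
    {T : N.RootedSubtree r} {i : ℕ} (h : G.InRound k a₀ j T i) (a : N.Arc) :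
    (G.loc r a.1).kind j a.2 = T.kind a := by
  have h1 : (G.loc r a.1).link a.2 = G.link a := Network.atPorts_port
  have h2 : a ∈ T.arcs ↔ (G.link a).any (· ≤ j) = true := by
    rw [h.mem_arcs]
    cases G.link a with
    | none => simp
    | some l => simp
  rw [NodeState.kind, h1, Network.RootedSubtree.kind]
  by_cases ha : a ∈ T.arcs
  · rw [if_pos ha, if_pos (h2.1 ha)]
  · rw [if_neg ha, if_neg (mt h2.2 ha)]

theorem carryAfter_loc (r : Fin n) (j : ℕ) (a : N.Arc) :
    (G.loc r a.1).carryAfter j a.2 = (G.crossed j a).getD (G.path a.1) := by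
  have h : (G.loc r a.1).crossed j a.2 = G.crossed j a := Network.atPorts_port
  rw [NodeState.carryAfter, h]
  rfl

theorem InRound.firstCarry_eq {G : GlobalState N} {k : ℕ} {r : Fin n} {a₀ : N.Arc} {j : ℕ}
    {T : N.RootedSubtree r} {i : ℕ} (h : G.InRound k a₀ j T (i + 1)) (h₀ : (a₀.2 : ℕ) = 0) :
    (G.loc r a₀.1).firstCarry = G.path (N.rev a₀).1 := by
  have h1 : (G.loc r a₀.1).heard 0 = G.heard a₀ := by
    rw [← h₀]
    exact Network.atPorts_port
  obtain ⟨x, hx⟩ := Option.ne_none_iff_exists'.1 (h.root_heard (Or.inr (Nat.succ_pos i)))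
  have h2 := (h.tree.heard_eq (N.rev a₀) x (by rwa [N.rev_rev])).1
  rw [NodeState.firstCarry, h1, hx, h2]
  rfl

end GlobalState

/-! ### The stages of an execution -/

namespace Config

open GlobalState

variable {n : ℕ} {N : Network n}

/-- The message that passes the token on along the `i`-th arc of the walk in round `j` is in transit. -/
structure OnWay (c : Config decompositionAlgorithm N) (k : ℕ) {r : Fin n} (a₀ : N.Arc) (j : ℕ)
    (T : N.RootedSubtree r) (i : ℕ) (G : GlobalState N) (z : List ℕ) : Prop where
  round : G.InRound k a₀ j T i
  le : j ≤ k
  no_return : ∀ m, 0 < m → m ≤ i → (T.walk ^ m) a₀ ≠ a₀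
  short : IsShort n k z
  last : j = k → G.InLastRound k a₀ T i ∧ z = G.path (T.apex a₀ ((T.walk ^ i) a₀))
  state : c.state = (G.visit j ((T.walk ^ i) a₀) z).loc r
  transit : c.transit = {⟨(T.walk ^ i) a₀,
    (G.token (T.kind ((T.walk ^ i) a₀)) j ((T.walk ^ i) a₀) z).encode, c.clock⟩}
  links : ∀ b, c.linkCount b ≤ 4 * j + 2 * N.hits T.walk a₀ b i +
    if (T.walk ^ i) a₀ = b ∨ (T.walk ^ i) a₀ = N.rev b then 1 else 0

/-- The answer to a probe along the `i`-th arc of the walk in round `j` is in transit. -/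
structure Answered (c : Config decompositionAlgorithm N) (k : ℕ) {r : Fin n} (a₀ : N.Arc) (j : ℕ)
    (T : N.RootedSubtree r) (i : ℕ) (a : N.Arc) (G : GlobalState N) : Prop where
  round : G.InRound k a₀ j T (i + 1)
  le : j ≤ k
  no_return : ∀ m, 0 < m → m ≤ i → (T.walk ^ m) a₀ ≠ a₀
  arc : (T.walk ^ i) a₀ = a
  notMem : a ∉ T.arcs
  last : j = k → G.InLastRound k a₀ T (i + 1)
  -- `G` anticipates the answer: it already contains what the probing node will learn from it. The
  -- actual configuration differs from `G` only at that node, where the state is still `s`.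
  state : ∃ (s : NodeState) (κ : Kind), c.state = Function.update (G.loc r) a.1 s ∧
    c.transit = {⟨N.rev a, (G.token κ j (N.rev a) []).encode, c.clock⟩} ∧
    ((κ = Kind.reject ∧ G.loc r a.1 = s.hear a.2 (G.info (N.rev a))) ∨
      (κ = Kind.accept ∧ G.loc r a.1 = (s.hear a.2 (G.info (N.rev a))).attach a.2 (j + 1)))
  links : ∀ b, c.linkCount b ≤ 4 * j + 2 * N.hits T.walk a₀ b (i + 1)

/-- The computation has ended. -/
structure Halted (c : Config decompositionAlgorithm N) (k : ℕ) {r : Fin n} (a₀ : N.Arc)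
    (T : N.RootedSubtree r) (i : ℕ) (G : GlobalState N) : Prop where
  round : G.InRound k a₀ k T (i + 1)
  return_eq : (T.walk ^ (i + 1)) a₀ = a₀
  last : G.InLastRound k a₀ T (i + 1)
  state : c.state = G.loc r
  transit : c.transit = 0
  links : ∀ b, c.linkCount b ≤ 4 * (k + 1)

/-- The configuration is in one of the above stages, of which `m` counts the number. -/
inductive Stage (c : Config decompositionAlgorithm N) (k : ℕ) (r : Fin n) (a₀ : N.Arc) : ℕ → Prop
  | onWay {j i : ℕ} {T : N.RootedSubtree r} {G : GlobalState N} {z : List ℕ}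
    (h : c.OnWay k a₀ j T i G z) : Stage c k r a₀ (j * (2 * Nat.card N.Arc) + 2 * i)
  | answered {j i : ℕ} {T : N.RootedSubtree r} {a : N.Arc} {G : GlobalState N}
    (h : c.Answered k a₀ j T i a G) : Stage c k r a₀ (j * (2 * Nat.card N.Arc) + 2 * i + 1)
  | halted {i : ℕ} {T : N.RootedSubtree r} {G : GlobalState N} (h : c.Halted k a₀ T i G) :
    Stage c k r a₀ ((k + 1) * (2 * Nat.card N.Arc))

section Advance

variable {k j i : ℕ} {r : Fin n} {a₀ d : N.Arc} {T : N.RootedSubtree r} {G : GlobalState N}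
  {z : List ℕ} {c : Config decompositionAlgorithm N} {s : NodeState}

theorem onWay_act {a : N.Arc} (ha : (T.walk ^ i) a₀ = a) (hG : G.InRound k a₀ j T i) (hj : j ≤ k)
    (hi : ∀ m, 0 < m → m ≤ i → (T.walk ^ m) a₀ ≠ a₀) (hz : IsShort n k z)
    (hlast : j = k → G.InLastRound k a₀ T i ∧ z = G.path (T.apex a₀ ((T.walk ^ i) a₀)))
    (hstate : c.state = Function.update (G.loc r) a.1 s)
    (htransit : c.transit = 0) (hlinks : ∀ b, c.linkCount b ≤ 4 * j + 2 * N.hits T.walk a₀ b i)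
    (t : ℝ) :
    (c.act a.1 t ((N.localInput k a.1).launch (G.loc r a.1) j a.2 z)).OnWay
      k a₀ j T i G z where
  round := hG
  le := hj
  no_return := hi
  short := hz
  last := hlast
  state := by
    have h : Function.update (Function.update (G.loc r) a.1 s) a.1 ((G.loc r a.1).visit j a.2 z) =
        (G.visit j a z).loc r := by
      rw [Function.update_idem, loc_visit]
    rw [ha, ← h]
    exact congrArg (fun f => Function.update f a.1 _) hstate
  transit := by
    change c.transit + _ = _
    rw [htransit, zero_add, ha, ← hG.kind_eq]
    rfl
  links b := by
    rw [ha]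
    exact (linkCount_act_singleton c a.1 t _ _ _ b).trans_le (Nat.add_le_add_right (hlinks b) _)

/-- Port 0 of the requesting node identifies `a₀`, so the local test in `advance` decides whether
the walk has returned. Then the computation halts or a new round begins; otherwise the walk goes on.
Only a lower bound on the new stage number holds, because a round may end early. -/
theorem advance_stage (hN : N.IsPlanarEmbedding)
    (hk : ∀ v, ∃ w : N.graph.Walk v r, w.length ≤ k) (h₀ : a₀.1 = r) (h₀' : (a₀.2 : ℕ) = 0)
    (hG : G.InRound k a₀ j T (i + 1)) (hj : j ≤ k)
    (hi : ∀ m, 0 < m → m ≤ i → (T.walk ^ m) a₀ ≠ a₀) (hz : IsShort n k z)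
    (hlast : j = k → G.InLastRound k a₀ T (i + 1) ∧ z = G.path (T.apex a₀ ((T.walk ^ (i + 1)) a₀)))
    (hd : N.turn d = (T.walk ^ (i + 1)) a₀) (hstate : c.state = Function.update (G.loc r) d.1 s)
    (htransit : c.transit = 0)
    (hlinks : ∀ b, c.linkCount b ≤ 4 * j + 2 * N.hits T.walk a₀ b (i + 1)) (t : ℝ) :
    (∃ m ≥ j * (2 * Nat.card N.Arc) + 2 * (i + 1),
      (c.act d.1 t ((N.localInput k d.1).advance (G.loc r d.1) j d.2 z)).Stage k r a₀ m) ∧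
    ∀ x ∈ ((N.localInput k d.1).advance (G.loc r d.1) j d.2 z).2, x.2.length ≤ maxBits n k := by
  have hcard := N.lt_card_arc hi
  have hbig : j * (2 * Nat.card N.Arc) + 2 * (i + 1) ≤ (j + 1) * (2 * Nat.card N.Arc) := by
    rw [Nat.add_mul, Nat.one_mul]
    exact Nat.add_le_add_left (by omega) _
  have hroot : ((G.loc r d.1).root = true ∧ ((N.turn d).2 : ℕ) = 0) ↔ (T.walk ^ (i + 1)) a₀ = a₀ := by
    rw [← hd]
    obtain ⟨v, p⟩ := a₀
    obtain ⟨w, q⟩ := d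
    simp only [loc, decide_eq_true_eq]
    constructor
    · rintro ⟨rfl, h2⟩
      cases h₀
      change (Sigma.mk _ _ : N.Arc) = _
      congr 1
      exact Fin.ext (h2.trans h₀'.symm)
    · intro h
      refine ⟨?_, ?_⟩
      · rw [← h₀, ← h]
        rfl
      · rw [h]
        exact h₀'
  have hsz : ∀ (l : ℕ) (y : List ℕ), l ≤ k → IsShort n k y →
      ∀ x ∈ ((N.localInput k d.1).launch (G.loc r d.1) l (N.turn d).2 y).2,
        x.2.length ≤ maxBits n k := by
    intro l y hl hy x hx
    rw [List.mem_singleton.1 hx]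
    exact G.length_encode_token_le hl _ (N.turn d) (hG.isShort_path hj _) hy
  rw [show (N.localInput k d.1).advance (G.loc r d.1) j d.2 z =
    if (G.loc r d.1).root = true ∧ ((N.turn d).2 : ℕ) = 0 then
      if j = k then (G.loc r d.1, []) else
        (N.localInput k d.1).launch (G.loc r d.1) (j + 1) (N.turn d).2 (G.loc r d.1).firstCarry
    else (N.localInput k d.1).launch (G.loc r d.1) j (N.turn d).2 z from rfl]
  by_cases hret : (T.walk ^ (i + 1)) a₀ = a₀
  · rw [if_pos (hroot.2 hret)]
    have hhits : ∀ b, c.linkCount b ≤ 4 * (j + 1) := fun b => by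
      have h1 := hlinks b
      have h2 := N.hits_le_two hi b
      omega
    by_cases hjk : j = k
    · subst hjk
      rw [if_pos rfl]
      refine ⟨⟨_, hbig, Stage.halted (i := i) (T := T) (G := G) ⟨hG, hret, (hlast rfl).1, ?_, ?_, ?_⟩⟩,
        ?_⟩
      · have h : Function.update (Function.update (G.loc r) d.1 s) d.1 (G.loc r d.1) = G.loc r := by
          rw [Function.update_idem, Function.update_eq_self]
        exact (congrArg (fun f => Function.update f d.1 _) hstate).trans h
      · change c.transit + 0 = 0
        rw [htransit, add_zero]
      · intro b
        exact (linkCount_act_nil c d.1 t _ b).trans_le (hhits b)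
      · exact fun x hx => absurd hx List.not_mem_nil
    · rw [if_neg hjk]
      have hd1 : d.1 = a₀.1 := by rw [← hret, ← hd, N.turn_fst]
      have hcarry : (G.loc r d.1).firstCarry = G.path (N.rev a₀).1 := by
        rw [hd1]
        exact hG.firstCarry_eq h₀'
      have hshort : IsShort n k (G.loc r d.1).firstCarry := hcarry ▸ hG.isShort_path hj _
      refine ⟨⟨_, ?_, Stage.onWay (onWay_act (T := hG.tree.subtree (j + 1)) (i := 0)
        (a := N.turn d) (hd.trans hret).symm (hG.next h₀ hret) (by omega) ?_ hshort ?_ hstate htransit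
        ?_ t)⟩,
        hsz _ _ (by omega) hshort⟩
      · rw [Nat.mul_zero, Nat.add_zero]
        exact hbig
      · intro m hm hm'
        omega
      -- On entry to the last round: `a₀` is the exit of its own face, so the apex is its head,
      -- whose path the root has heard in an earlier round.
      · rintro rfl
        have h1 := hG.inLastRound h₀ hret hk
        refine ⟨h1, ?_⟩
        rw [hcarry, pow_zero, Equiv.Perm.one_apply,
          Network.RootedSubtree.apex_of_mem_exits _ h1.spanning hN (Or.inl rfl)]
      · exact fun b => (hhits b).trans (Nat.le_add_right _ _)
  · rw [if_neg (mt hroot.1 hret)]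
    refine ⟨⟨_, le_rfl, Stage.onWay (onWay_act hd.symm hG hj ?_ hz hlast hstate htransit hlinks t)⟩,
      hsz _ _ hj hz⟩
    intro m hm hm'
    rcases Nat.le_succ_iff.1 hm' with hm' | rfl
    · exact hi m hm hm'
    · exact hret

end Advance

end Config

namespace LocalInput

variable (inp : LocalInput) (s : NodeState) (q : Fin inp.deg) (j p p' : ℕ) (l z : List ℕ)

theorem react_probe_of_eq (h : s.path = []) : inp.react s q ⟨Kind.probe, j, p, p', l, z⟩ =
    inp.reply ((((s.hear q (p, p', l)).cross j q z)).join inp.ident q (j + 1) l) Kind.accept j q :=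
  if_pos h

theorem react_probe_of_ne (h : s.path ≠ []) : inp.react s q ⟨Kind.probe, j, p, p', l, z⟩ =
    inp.reply ((s.hear q (p, p', l)).cross j q z) Kind.reject j q :=
  if_neg h

end LocalInput

namespace Config

open GlobalState

variable {n : ℕ} {N : Network n} {k : ℕ} {r : Fin n} {a₀ : N.Arc}

/-- `m` counts the number of the stage of the configuration, and bounds the time. -/
structure Tracked (c : Config decompositionAlgorithm N) (k : ℕ) (r : Fin n) (a₀ : N.Arc) (m : ℕ) :
    Prop where
  stage : c.Stage k r a₀ m
  clock_le : c.clock ≤ m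
  length_le : ∀ p ∈ c.sent, p.body.length ≤ maxBits n k

theorem tracked_act {c : Config decompositionAlgorithm N} {v : Fin n} {t : ℝ}
    {x : NodeState × List (Fin (N.deg v) × Message)} {m : ℕ} (hs : (c.act v t x).Stage k r a₀ m)
    (ht : t ≤ m) (hc : ∀ p ∈ c.sent, p.body.length ≤ maxBits n k)
    (hx : ∀ y ∈ x.2, y.2.length ≤ maxBits n k) : (c.act v t x).Tracked k r a₀ m where
  stage := hs
  clock_le := ht
  length_le p hp := by
    rcases Multiset.mem_add.1 hp with hp | hp
    · exact hc p hp
    · obtain ⟨y, hy, rfl⟩ := List.mem_map.1 (Multiset.mem_coe.1 hp)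
      exact hx y hy

/-- A walk that has not yet returned has made fewer steps than there are arcs, so with two stages
per step the numbers of one round stay within its block. -/
theorem Stage.le {c : Config decompositionAlgorithm N} {m : ℕ} (h : c.Stage k r a₀ m) :
    m ≤ (k + 1) * (2 * Nat.card N.Arc) := by
  have key : ∀ j i : ℕ, j ≤ k → i < Nat.card N.Arc →
      j * (2 * Nat.card N.Arc) + 2 * i + 1 ≤ (k + 1) * (2 * Nat.card N.Arc) := by
    intro j i hj hi
    have h1 := Nat.mul_le_mul_right (2 * Nat.card N.Arc) (Nat.succ_le_succ hj)
    rw [Nat.succ_eq_add_one, Nat.add_mul, Nat.one_mul] at h1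
    refine le_trans ?_ h1
    rw [Nat.add_assoc]
    exact Nat.add_le_add_left (by omega) _
  cases h with
  | onWay h => exact (Nat.le_succ _).trans (key _ _ h.le (N.lt_card_arc h.no_return))
  | answered h => exact key _ _ h.le (N.lt_card_arc h.no_return)
  | halted h => exact le_rfl

/-- Per round at most two meetings of the link, each with at most a probe and its answer: four
messages. -/
theorem Stage.linkCount_le {c : Config decompositionAlgorithm N} {m : ℕ} (h : c.Stage k r a₀ m)
    (b : N.Arc) : c.linkCount b ≤ 4 * (k + 1) := by
  cases h with
  | @onWay j i T _ _ h =>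
    have h1 := h.links b
    have h2 := N.hits_le_two h.no_return b
    have h3 := h.le
    rw [N.hits_succ] at h2
    omega
  | answered h =>
    have h1 := h.links b
    have h2 := N.hits_le_two h.no_return b
    have h3 := h.le
    omega
  | halted h => exact h.links b

theorem OnWay.step_move {c : Config decompositionAlgorithm N} {j i : ℕ} {T : N.RootedSubtree r}
    {G : GlobalState N} {z : List ℕ} (hN : N.IsPlanarEmbedding)
    (hk : ∀ v, ∃ w : N.graph.Walk v r, w.length ≤ k) (h₀ : a₀.1 = r) (h₀' : (a₀.2 : ℕ) = 0)
    (h : c.OnWay k a₀ j T i G z) {a : N.Arc} (ha : (T.walk ^ i) a₀ = a) (hat : a ∈ T.arcs) (t : ℝ) :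
    (∃ m ≥ j * (2 * Nat.card N.Arc) + 2 * (i + 1),
      (Config.act { c with transit := 0 } (N.rev a).1 t
        ((N.localInput k (N.rev a).1).react (c.state (N.rev a).1) (N.rev a).2
          (G.token Kind.move j a z))).Stage k r a₀ m) ∧
    ∀ x ∈ ((N.localInput k (N.rev a).1).react (c.state (N.rev a).1) (N.rev a).2
          (G.token Kind.move j a z)).2, x.2.length ≤ maxBits n k := by
  have hnext : N.turn (N.rev a) = (T.walk ^ (i + 1)) a₀ := by
    rw [pow_succ', Equiv.Perm.mul_apply, ha, T.walk_of_mem hat]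
  have hloc : (((G.visit j a z).hear a).loc r) (N.rev a).1 =
      ((G.visit j a z).loc r (N.rev a).1).hear (N.rev a).2 (G.info a) := by
    rw [loc_hear, Function.update_self]
    rfl
  have hst : c.state = (G.visit j a z).loc r := ha ▸ h.state
  have hst' : (G.visit j a z).loc r = Function.update (((G.visit j a z).hear a).loc r) (N.rev a).1
      ((G.visit j a z).loc r (N.rev a).1) := by
    rw [loc_hear, Function.update_idem, Function.update_eq_self]
  have hcs : c.state (N.rev a).1 = (G.visit j a z).loc r (N.rev a).1 := by rw [hst]
  rw [hcs]
  have hround : ((G.visit j a z).hear a).InRound k a₀ j T (i + 1) := by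
    subst ha
    exact h.round.move h₀ hat z
  have key := advance_stage (c := { c with transit := 0 }) hN hk h₀ h₀' hround h.le h.no_return
    h.short (fun hj => by
      subst hj
      obtain ⟨h1, h2⟩ := h.last rfl
      refine ⟨h1.move h.no_return ha hat (ha ▸ h2), ?_⟩
      rw [pow_succ', Equiv.Perm.mul_apply, ha, T.apex_walk_of_mem h1.spanning hN hat]
      exact ha ▸ h2) hnext (hst.trans hst') rfl (fun b => by
      have hb := h.links b
      rw [N.hits_succ]
      change c.linkCount b ≤ _
      omega) t
  rw [hloc] at key
  exact key

theorem OnWay.step_probe {c : Config decompositionAlgorithm N} {j i : ℕ} {T : N.RootedSubtree r}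
    {G : GlobalState N} {z : List ℕ} (h₀ : a₀.1 = r)
    (h : c.OnWay k a₀ j T i G z) {a : N.Arc} (ha : (T.walk ^ i) a₀ = a) (hat : a ∉ T.arcs) (t : ℝ) :
    (∃ G', (Config.act { c with transit := 0 } (N.rev a).1 t
        ((N.localInput k (N.rev a).1).react (c.state (N.rev a).1) (N.rev a).2
          (G.token Kind.probe j a z))).Answered k a₀ j T i a G') ∧
    ∀ x ∈ ((N.localInput k (N.rev a).1).react (c.state (N.rev a).1) (N.rev a).2
          (G.token Kind.probe j a z)).2, x.2.length ≤ maxBits n k := by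
  have hst : c.state = (G.visit j a z).loc r := ha ▸ h.state
  have hcs : c.state (N.rev a).1 = (G.visit j a z).loc r (N.rev a).1 := by rw [hst]
  set H := ((G.visit j a z).hear a).cross j (N.rev a) z with hH
  have hHloc : H.loc r = Function.update ((G.visit j a z).loc r) (N.rev a).1
      ((((G.visit j a z).loc r (N.rev a).1).hear (N.rev a).2 (G.info a)).cross j (N.rev a).2 z) := by
    rw [hH, loc_cross, loc_hear, Function.update_idem, Function.update_self]
    rfl
  have hlinks : ∀ (s : NodeState) (m : Message) (b : N.Arc),
      (Config.act { c with transit := 0 } (N.rev a).1 t (s, [((N.rev a).2, m)])).linkCount b ≤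
        4 * j + 2 * N.hits T.walk a₀ b (i + 1) := by
    intro s m b
    refine (linkCount_act_singleton { c with transit := 0 } (N.rev a).1 t s (N.rev a).2 m b).trans_le ?_
    change c.linkCount b + (if N.rev a = b ∨ N.rev a = N.rev b then 1 else 0) ≤ _
    have hb := h.links b
    have h1 : (N.rev a = b ∨ N.rev a = N.rev b) ↔ (a = b ∨ a = N.rev b) := by
      rw [N.rev_eq_iff, N.rev_injective.eq_iff]
      exact or_comm
    rw [N.hits_succ, ha]
    rw [ha] at hb
    simp only [h1]
    omega
  by_cases hp : G.path (N.rev a).1 = []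
  · set K := H.join (N.rev a) (j + 1) with hK
    have hKloc : K.loc r = Function.update ((G.visit j a z).loc r) (N.rev a).1
        (((((G.visit j a z).loc r (N.rev a).1).hear (N.rev a).2 (G.info a)).cross j
          (N.rev a).2 z).join (((N.rev a).1 : ℕ) + 1) (N.rev a).2 (j + 1) (G.path a.1)) := by
      have hpath : H.path (N.rev (N.rev a)).1 = G.path a.1 := by rw [N.rev_rev]; rfl
      rw [hK, loc_join, hHloc, Function.update_idem, Function.update_self, hpath]
    have hKs := congrFun hKloc (N.rev a).1
    rw [Function.update_self] at hKs
    have hround := h.round.probe_accept h₀ ha hp h.short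
    have hreact : (N.localInput k (N.rev a).1).react ((G.visit j a z).loc r (N.rev a).1) (N.rev a).2
        (G.token Kind.probe j a z) = (K.loc r (N.rev a).1, [((N.rev a).2,
          (K.token Kind.accept j (N.rev a) []).encode)]) := by
      rw [hKs]
      refine (LocalInput.react_probe_of_eq _ _ _ _ _ _ _ _ hp).trans ?_
      have : (K.token Kind.accept j (N.rev a) []).path = _ := congrArg NodeState.path hKs
      exact congrArg (fun l => (_, [((N.rev a).2, Token.encode
        ⟨Kind.accept, j, (N.rev a).2, (N.turn (N.rev a)).2, l, []⟩)])) this.symm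
    rw [hcs, hreact]
    refine ⟨⟨(K.attach a (j + 1)).hear (N.rev a), hround, h.le, h.no_return, ha, hat, ?_, ?_,
      hlinks _ _⟩, ?_⟩
    -- In the last round the tree spans the network, so no probed node can lack a path and no join
    -- occurs.
    · rintro rfl
      have := (h.round.mem_nodes _).1 ((h.last rfl).1.spanning (N.rev a).1)
      exact absurd hp this.1
    · refine ⟨K.loc r a.1, Kind.accept, ?_, ?_, Or.inr ⟨rfl, ?_⟩⟩
      · have h1 : Function.update ((G.visit j a z).loc r) (N.rev a).1 (K.loc r (N.rev a).1) =
            Function.update (((K.attach a (j + 1)).hear (N.rev a)).loc r) a.1 (K.loc r a.1) := by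
          rw [loc_hear, loc_attach, N.rev_rev, Function.update_idem, Function.update_idem,
            Function.update_eq_self, hKs, hKloc]
        rw [← h1]
        exact congrArg (fun f => Function.update f (N.rev a).1 _) hst
      · exact zero_add _
      · rw [loc_hear, loc_attach, N.rev_rev, Function.update_self, Function.update_self]
        rfl
    · intro x hx
      rw [List.mem_singleton.1 hx]
      exact K.length_encode_token_le h.le _ _ (hround.isShort_path h.le _)
        ⟨Nat.zero_le _, fun y hy => absurd hy List.not_mem_nil⟩
  · have hHs := congrFun hHloc (N.rev a).1
    rw [Function.update_self] at hHs
    have hround := h.round.probe_reject h₀ ha hp h.short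
    have hreact : (N.localInput k (N.rev a).1).react ((G.visit j a z).loc r (N.rev a).1) (N.rev a).2
        (G.token Kind.probe j a z) = (H.loc r (N.rev a).1, [((N.rev a).2,
          (H.token Kind.reject j (N.rev a) []).encode)]) := by
      rw [hHs]
      exact LocalInput.react_probe_of_ne _ _ _ _ _ _ _ _ hp
    rw [hcs, hreact]
    refine ⟨⟨H.hear (N.rev a), hround, h.le, h.no_return, ha, hat, ?_, ?_, hlinks _ _⟩, ?_⟩
    · rintro rfl
      obtain ⟨h1, h2⟩ := h.last rfl
      exact h1.probe h.no_return ha hat (ha ▸ h2)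
    · refine ⟨H.loc r a.1, Kind.reject, ?_, ?_, Or.inl ⟨rfl, ?_⟩⟩
      · have h1 : Function.update ((G.visit j a z).loc r) (N.rev a).1 (H.loc r (N.rev a).1) =
            Function.update ((H.hear (N.rev a)).loc r) a.1 (H.loc r a.1) := by
          rw [loc_hear, N.rev_rev, Function.update_idem, Function.update_eq_self, hHs, hHloc]
        rw [← h1]
        exact congrArg (fun f => Function.update f (N.rev a).1 _) hst
      · exact zero_add _
      · rw [loc_hear, N.rev_rev, Function.update_self]
        rfl
    · intro x hx
      rw [List.mem_singleton.1 hx]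
      exact H.length_encode_token_le h.le _ _ (hround.isShort_path h.le _)
        ⟨Nat.zero_le _, fun y hy => absurd hy List.not_mem_nil⟩

theorem Answered.step {c : Config decompositionAlgorithm N} {j i : ℕ} {T : N.RootedSubtree r}
    {G : GlobalState N} {a : N.Arc} (hN : N.IsPlanarEmbedding)
    (hk : ∀ v, ∃ w : N.graph.Walk v r, w.length ≤ k) (h₀ : a₀.1 = r) (h₀' : (a₀.2 : ℕ) = 0)
    (h : c.Answered k a₀ j T i a G) :
    ∃ κ, c.transit = {⟨N.rev a, (G.token κ j (N.rev a) []).encode, c.clock⟩} ∧ ∀ t : ℝ,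
    (∃ m ≥ j * (2 * Nat.card N.Arc) + 2 * (i + 1),
      (Config.act { c with transit := 0 } a.1 t
        ((N.localInput k a.1).react (c.state a.1) a.2
          (G.token κ j (N.rev a) []))).Stage k r a₀ m) ∧
    ∀ x ∈ ((N.localInput k a.1).react (c.state a.1) a.2
          (G.token κ j (N.rev a) [])).2, x.2.length ≤ maxBits n k := by
  obtain ⟨s, κ, hst, htr, hκ⟩ := h.state
  refine ⟨κ, htr, fun t => ?_⟩
  have hcs : c.state a.1 = s := by
    rw [hst]
    exact Function.update_self _ _ _
  have hreact : (N.localInput k a.1).react s a.2 (G.token κ j (N.rev a) []) =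
      (N.localInput k a.1).advance (G.loc r a.1) j a.2 ((G.crossed j a).getD (G.path a.1)) := by
    rw [← G.carryAfter_loc r j a]
    rcases hκ with ⟨rfl, hκ⟩ | ⟨rfl, hκ⟩
    · rw [hκ]
      rfl
    · rw [hκ]
      rfl
  rw [hcs, hreact]
  have hnext : (T.walk ^ (i + 1)) a₀ = N.turn a := by
    rw [pow_succ', Equiv.Perm.mul_apply, h.arc, T.walk_of_notMem h.notMem]
  refine advance_stage (c := { c with transit := 0 }) hN hk h₀ h₀' h.round h.le h.no_return ?_ ?_
    hnext.symm hst rfl h.links t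
  · cases hc : G.crossed j a with
    | none => exact h.round.isShort_path h.le _
    | some y => exact h.round.crossed_short _ _ _ hc
  · rintro rfl
    refine ⟨h.last rfl, ?_⟩
    rw [hnext, ← T.walk_of_notMem h.notMem]
    exact (h.last rfl).carry_after_probe hN h.no_return h.arc h.notMem

/-- The message in transit is the only one and was sent at the current clock, so the step is
determined up to its time, and the clock grows by at most 1 while the stage number grows by at least
1. -/
theorem Tracked.step (hN : N.IsPlanarEmbedding)
    (hk : ∀ v, ∃ w : N.graph.Walk v r, w.length ≤ k) (h₀ : a₀.1 = r) (h₀' : (a₀.2 : ℕ) = 0)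
    {c c' : Config decompositionAlgorithm N} {m : ℕ} (h : c.Tracked k r a₀ m) (hs : Step k c c') :
    ∃ m' > m, c'.Tracked k r a₀ m' := by
  obtain ⟨hstage, hclock, hlen⟩ := h
  obtain ⟨p, rest, t, htr, -, hdelay, rfl⟩ := hs
  have single : ∀ q : Packet N, c.transit = {q} → q.time = c.clock →
      p = q ∧ rest = 0 ∧ t ≤ m + 1 := by
    intro q hq hqt
    have h1 : ({q} : Multiset (Packet N)) = p ::ₘ rest := hq.symm.trans htr
    obtain ⟨h2, h3⟩ := (Multiset.singleton_eq_cons_iff _).1 h1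
    refine ⟨h2.symm, h3, ?_⟩
    have := hdelay q (by rw [hq]; exact Multiset.mem_singleton_self q)
    linarith
  cases hstage with
  | @onWay j i T G z h =>
    obtain ⟨rfl, rfl, ht⟩ := single _ h.transit rfl
    dsimp only
    rw [Token.decode_encode]
    generalize ha : (T.walk ^ i) a₀ = a
    by_cases hat : a ∈ T.arcs
    · rw [Network.RootedSubtree.kind, if_pos hat]
      obtain ⟨⟨m', hm', hstage⟩, hsz⟩ := h.step_move hN hk h₀ h₀' ha hat t
      refine ⟨m', by omega, tracked_act hstage (ht.trans ?_) hlen hsz⟩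
      exact_mod_cast (by omega : j * (2 * Nat.card N.Arc) + 2 * i + 1 ≤ m')
    · rw [Network.RootedSubtree.kind, if_neg hat]
      obtain ⟨⟨G', hG'⟩, hsz⟩ := h.step_probe h₀ ha hat t
      refine ⟨_, Nat.lt_succ_self _, tracked_act (Stage.answered hG') (ht.trans ?_) hlen hsz⟩
      push_cast
      exact le_rfl
  | @answered j i T a G h =>
    obtain ⟨κ, htr', hstep⟩ := h.step hN hk h₀ h₀'
    obtain ⟨rfl, rfl, ht⟩ := single _ htr' rfl
    dsimp only
    rw [Token.decode_encode, N.rev_rev]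
    obtain ⟨⟨m', hm', hstage⟩, hsz⟩ := hstep t
    refine ⟨m', by omega, tracked_act hstage (ht.trans ?_) hlen hsz⟩
    exact_mod_cast (by omega : j * (2 * Nat.card N.Arc) + 2 * i + 1 + 1 ≤ m')
  | halted h =>
    rw [h.transit] at htr
    exact absurd htr.symm (Multiset.cons_ne_zero)

end Config

/-! ### The initial configuration and termination -/

namespace GlobalState

variable {n : ℕ} {N : Network n}

theorem _root_.Network.atPorts_const {β : Type} (d : β) (v : Fin n) :
    N.atPorts (fun _ => d) d v = fun _ => d := by
  funext p
  exact ite_self d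

/-- The state in which only the requesting node `r` is in the tree. -/
def start (N : Network n) (r : Fin n) : GlobalState N where
  path v := if v = r then [(r : ℕ) + 1] else []
  level _ := 0
  up := ∅
  link _ := none
  heard _ := none
  crossed _ _ := none
  apex _ := []
  exit _ := false

theorem start_path_ne {r v : Fin n} : (start N r).path v ≠ [] ↔ v = r := by
  simp [start]

theorem start_isTree (r : Fin n) : (start N r).IsTree r 1 where
  root_path := if_pos rfl
  root_level := rfl
  level_le _ _ := Nat.zero_le _
  up_inj a ha := ha.elim
  up_path a ha := ha.elim
  up_head a ha := ha.elim
  up_level a ha := ha.elim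
  up_ne a ha := ha.elim
  exists_up v hv := Or.inl (start_path_ne.1 hv)
  link_iff a i := iff_of_false (Option.some_ne_none i).symm fun h => h.elim (·.1) (·.1)
  heard_eq a x h := absurd h.symm (Option.some_ne_none x)
  length_path v := by
    simp only [start]
    split_ifs <;> simp
  mem_path v x hx := by
    simp only [start] at hx
    split_ifs at hx
    · exact ⟨r, List.mem_singleton.1 hx⟩
    · exact absurd hx List.not_mem_nil

theorem start_inRound (k : ℕ) {r : Fin n} (a₀ : N.Arc) :
    (start N r).InRound k a₀ 0 ((start_isTree (N := N) r).subtree 0) 0 where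
  tree := start_isTree r
  mem_nodes v := (start_isTree r).mem_nodes_subtree
  mem_arcs a := (start_isTree r).mem_arcs_subtree
  ball v w hw := Or.inl (SimpleGraph.Walk.eq_of_length_eq_zero (Nat.le_zero.1 hw))
  heard m hm := absurd hm (Nat.not_lt_zero m)
  root_heard h := by omega
  crossed_none _ _ _ := rfl
  crossed_short _ _ z h := absurd h.symm (Option.some_ne_none z)

end GlobalState

namespace Config

open GlobalState

variable {n : ℕ} {N : Network n} {k : ℕ} {r : Fin n} {a₀ : N.Arc}

/-- At the start the root does not know the path of its first neighbor, so the token carries the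
empty list. This is harmless unless round 0 is already the last one; hence `k ≠ 0`. -/
theorem tracked_initial (hk : k ≠ 0) (h₀ : a₀.1 = r) (h₀' : (a₀.2 : ℕ) = 0) :
    (Config.initial decompositionAlgorithm N k r).Tracked k r a₀ 0 := by
  subst h₀
  have hpos : 0 < N.deg a₀.1 := (Nat.zero_le _).trans_lt a₀.2.2
  have hp : (⟨0, hpos⟩ : Fin (N.deg a₀.1)) = a₀.2 := Fin.ext h₀'.symm
  have hloc : (start N a₀.1).loc a₀.1 a₀.1 =
      { decompositionAlgorithm.initState (N.localInput k a₀.1) with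
        root := true
        path := [(a₀.1 : ℕ) + 1] } := by
    simp [loc, start, Network.atPorts_const]
  have hstate : (fun v => decompositionAlgorithm.initState (N.localInput k v)) =
      Function.update ((start N a₀.1).loc a₀.1) a₀.1
        (decompositionAlgorithm.initState (N.localInput k a₀.1)) := by
    funext v
    by_cases hv : v = a₀.1
    · subst hv
      rw [Function.update_self]
    · rw [Function.update_of_ne hv]
      simp [loc, start, Network.atPorts_const, hv]
  have hinit : decompositionAlgorithm.start (N.localInput k a₀.1)
      (decompositionAlgorithm.initState (N.localInput k a₀.1)) =
      (N.localInput k a₀.1).launch ((start N a₀.1).loc a₀.1 a₀.1) 0 a₀.2 [] := by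
    rw [hloc, ← hp]
    exact dif_pos hpos
  have hnil : IsShort n k [] := ⟨Nat.zero_le _, fun x hx => absurd hx List.not_mem_nil⟩
  have hround := start_inRound (N := N) k (r := a₀.1) a₀
  have hway := onWay_act (c := ⟨fun v => decompositionAlgorithm.initState (N.localInput k v), 0, 0, 0⟩)
    (i := 0) (a := a₀) rfl hround (Nat.zero_le k) (fun m hm hm' => by omega) hnil
    (fun h => absurd h.symm hk) hstate rfl (fun b => Nat.zero_le _) 0
  have hstage := Stage.onWay hway
  rw [Nat.zero_mul, Nat.mul_zero, Nat.zero_add] at hstage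
  rw [Config.initial, hinit]
  refine tracked_act hstage (by simp) (fun p hp => absurd hp (Multiset.notMem_zero p)) ?_
  intro x hx
  rw [List.mem_singleton.1 hx]
  exact (start N a₀.1).length_encode_token_le (Nat.zero_le k) _ a₀
    (hround.isShort_path (Nat.zero_le k) _) hnil

theorem exists_tracked_of_reachable (hN : N.IsPlanarEmbedding)
    (hk : ∀ v, ∃ w : N.graph.Walk v r, w.length ≤ k) (hk0 : k ≠ 0) (h₀ : a₀.1 = r)
    (h₀' : (a₀.2 : ℕ) = 0) {c : Config decompositionAlgorithm N} (hc : c.Reachable k r) :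
    ∃ m, c.Tracked k r a₀ m := by
  induction hc with
  | refl => exact ⟨0, tracked_initial hk0 h₀ h₀'⟩
  | tail _ hs ih =>
    obtain ⟨m, hm⟩ := ih
    obtain ⟨m', -, hm'⟩ := hm.step hN hk h₀ h₀' hs
    exact ⟨m', hm'⟩

theorem not_exists_infinite (hN : N.IsPlanarEmbedding)
    (hk : ∀ v, ∃ w : N.graph.Walk v r, w.length ≤ k) (hk0 : k ≠ 0) (h₀ : a₀.1 = r)
    (h₀' : (a₀.2 : ℕ) = 0) :
    ¬ ∃ e : ℕ → Config decompositionAlgorithm N, e 0 = Config.initial decompositionAlgorithm N k r ∧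
      ∀ i, Config.Step k (e i) (e (i + 1)) := by
  rintro ⟨e, he0, he⟩
  have key : ∀ i, ∃ m ≥ i, (e i).Tracked k r a₀ m := by
    intro i
    induction i with
    | zero => exact ⟨0, le_rfl, he0 ▸ tracked_initial hk0 h₀ h₀'⟩
    | succ i ih =>
      obtain ⟨m, hm, ht⟩ := ih
      obtain ⟨m', hm', ht'⟩ := ht.step hN hk h₀ h₀' (he i)
      exact ⟨m', by omega, ht'⟩
  obtain ⟨m, hm, ht⟩ := key ((k + 1) * (2 * Nat.card N.Arc) + 1)
  have := ht.stage.le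
  omega

end Config

/-! ### Reading off the stored decomposition -/

theorem Network.storesDecomposition_ofFn {n : ℕ} {N : Network n} {k : ℕ} {r : Fin n}
    (F : RootedTreeOn N.Arc) (L : N.Arc → Fin (3 * k + 1) → Fin n)
    (hF : IsOrderedTreeDecomposition N.graph F L) (hr : F.root.1 = r)
    (g : ∀ v, Fin (N.deg v) → StoredBag (3 * k) (N.deg v))
    (hg : ∀ a : N.Arc, (∀ i, (g a.1 a.2).label i = (L a i : ℕ) + 1) ∧
      (F.father a = none → (g a.1 a.2).father = none) ∧
      ∀ b, F.father a = some b → ∃ p : Fin (N.deg a.1),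
        (g a.1 a.2).father = some (p, (b.2 : ℕ)) ∧ N.neighbor a.1 p = b.1) :
    StoresDecomposition N k r fun v => List.ofFn (g v) := by
  -- The length of the stored list equals the degree only propositionally. Generalizing it to `ℓ`
  -- allows the equation to be eliminated, so that stored bags become arcs.
  have key : ∀ (ℓ : Fin n → ℕ) (hℓ : ℓ = N.deg) (out : ∀ v, Fin (ℓ v) → StoredBag (3 * k) (N.deg v)),
      (∀ v p, out v p = g v (Fin.cast (congrFun hℓ v) p)) →
      ∃ (F : RootedTreeOn (Σ v : Fin n, Fin (ℓ v)))
        (L : (Σ v : Fin n, Fin (ℓ v)) → Fin (3 * k + 1) → Fin n),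
        IsOrderedTreeDecomposition N.graph F L ∧ F.root.1 = r ∧
        ∀ b : (Σ v : Fin n, Fin (ℓ v)),
          (∀ i, (out b.1 b.2).label i = (L b i : ℕ) + 1) ∧
          (F.father b = none → (out b.1 b.2).father = none) ∧
          ∀ b', F.father b = some b' →
            ∃ p : Fin (N.deg b.1), (out b.1 b.2).father = some (p, (b'.2 : ℕ)) ∧
              N.neighbor b.1 p = b'.1 := by
    rintro ℓ rfl out hout
    refine ⟨F, L, hF, hr, fun b => ?_⟩
    rw [hout]
    exact hg b
  exact key (fun v => (List.ofFn (g v)).length) (funext fun v => List.length_ofFn)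
    (fun v p => (List.ofFn (g v)).get p) fun v p => List.get_ofFn (g v) p

/-- The entries of a bag, with the last entry, the root, taken only once. -/
theorem mem_range_getD_iff {l₁ l₂ m₁ m₂ m₃ : List ℕ} {ρ x w : ℕ} (h₁ : l₁ = m₁ ++ [ρ])
    (h₂ : l₂ = m₂ ++ [ρ]) {l₃ : List ℕ} (h₃ : l₃ = m₃ ++ [ρ])
    (hw : (l₁.dropLast ++ l₂.dropLast ++ l₃).length ≤ w) :
    (∃ i < w, (l₁.dropLast ++ l₂.dropLast ++ l₃).getD i (l₃.getLast?.getD 0) = x) ↔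
      x ∈ l₁ ∨ x ∈ l₂ ∨ x ∈ l₃ := by
  subst h₁ h₂ h₃
  have hlast : ((m₃ ++ [ρ]).getLast?.getD 0) = ρ := by simp
  rw [hlast]
  simp only [List.dropLast_concat] at hw ⊢
  have hmem : (x ∈ m₁ ++ [ρ] ∨ x ∈ m₂ ++ [ρ] ∨ x ∈ m₃ ++ [ρ]) ↔ x ∈ m₁ ++ m₂ ++ (m₃ ++ [ρ]) := by
    simp only [List.mem_append, List.mem_singleton]
    tauto
  rw [hmem]
  constructor
  · rintro ⟨i, -, rfl⟩
    by_cases hi : i < (m₁ ++ m₂ ++ (m₃ ++ [ρ])).length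
    · rw [List.getD_eq_getElem _ _ hi]
      exact List.getElem_mem hi
    · rw [List.getD_eq_default _ _ (not_lt.1 hi)]
      simp
  · intro hx
    obtain ⟨i, hi, rfl⟩ := List.getElem_of_mem hx
    exact ⟨i, hi.trans_le hw, List.getD_eq_getElem _ _ hi⟩

namespace Config

open GlobalState

variable {n : ℕ} {N : Network n} {k : ℕ} {r : Fin n} {a₀ : N.Arc}

theorem Halted.storesDecomposition {c : Config decompositionAlgorithm N} {T : N.RootedSubtree r}
    {i : ℕ} {G : GlobalState N} (hN : N.IsPlanarEmbedding) (h₀ : a₀.1 = r) (h₀' : (a₀.2 : ℕ) = 0)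
    (h : c.Halted k a₀ T i G) :
    StoresDecomposition N k r
      fun v => decompositionAlgorithm.output (N.localInput k v) (c.state v) := by
  have hT := h.last.spanning
  have hvisit : ∀ a : N.Arc, ∃ m < i + 1, (T.walk ^ m) a₀ = a := fun a =>
    (T.sameCycle_contour (hT _) (hT _)).exists_pow_lt h.return_eq
  have hheard : ∀ a : N.Arc, (G.loc r a.1).heard a.2 = some (G.info (N.rev a)) := by
    intro a
    obtain ⟨m, hm, hma⟩ := hvisit (N.rev a)
    have h1 := (h.round.heard m hm).1
    rw [hma, N.rev_rev] at h1
    obtain ⟨x, hx⟩ := Option.ne_none_iff_exists'.1 h1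
    have h2 := (h.round.tree.heard_eq (N.rev a) x (by rwa [N.rev_rev])).1
    rw [← h2, ← hx]
    exact Network.atPorts_port
  have hapex : ∀ a : N.Arc, (G.loc r a.1).apex a.2 = G.path (T.apex a₀ a) := by
    intro a
    obtain ⟨m, hm, rfl⟩ := hvisit a
    rw [← h.last.apex m hm]
    exact Network.atPorts_port
  have hexit : ∀ a : N.Arc, (G.loc r a.1).exit a.2 = true ↔ a ∈ T.closing a₀ := by
    intro a
    obtain ⟨m, hm, rfl⟩ := hvisit a
    rw [← h.last.exit m hm]
    exact Eq.congr_left Network.atPorts_port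
  have hroot : ∀ a : N.Arc, ((G.loc r a.1).root = true ∧ (a.2 : ℕ) = 0) ↔ a = a₀ := by
    rintro ⟨v, p⟩
    obtain ⟨w, q⟩ := a₀
    simp only [loc, decide_eq_true_eq]
    constructor
    · rintro ⟨rfl, h2⟩
      cases h₀
      exact congrArg _ (Fin.ext (h2.trans h₀'.symm))
    · intro h
      cases h
      exact ⟨h₀, h₀'⟩
  have hne : ∀ v, G.path v ≠ [] := fun v => ((h.round.mem_nodes v).1 (hT v)).1
  have hlen : ∀ v, (G.path v).length ≤ k + 1 := fun v =>
    (h.round.tree.length_path v).trans (Nat.succ_le_succ ((h.round.mem_nodes v).1 (hT v)).2)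
  set E : N.Arc → List ℕ := fun a =>
    (G.path (T.apex a₀ a)).dropLast ++ (G.path a.1).dropLast ++ G.path (N.rev a).1 with hE
  -- Two paths lose the root and one keeps it: k + k + (k + 1) entries.
  have hElen : ∀ a, (E a).length ≤ 3 * k + 1 := by
    intro a
    have h1 := hlen (T.apex a₀ a)
    have h2 := hlen a.1
    have h3 := hlen (N.rev a).1
    simp only [hE, List.length_append, List.length_dropLast]
    omega
  have hmem : ∀ (a : N.Arc) (x : ℕ), (∃ i < 3 * k + 1,
      (E a).getD i ((G.path (N.rev a).1).getLast?.getD 0) = x) ↔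
      x ∈ G.path (T.apex a₀ a) ∨ x ∈ G.path a.1 ∨ x ∈ G.path (N.rev a).1 := by
    intro a x
    obtain ⟨m₁, h₁⟩ := h.round.tree.getLast_path (hne (T.apex a₀ a))
    obtain ⟨m₂, h₂⟩ := h.round.tree.getLast_path (hne a.1)
    obtain ⟨m₃, h₃⟩ := h.round.tree.getLast_path (hne (N.rev a).1)
    exact mem_range_getD_iff h₁ h₂ h₃ (hElen a)
  have hL : ∀ (a : N.Arc) (i : Fin (3 * k + 1)), ∃ u : Fin n,
      (E a).getD i ((G.path (N.rev a).1).getLast?.getD 0) = u + 1 := by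
    intro a i
    rcases (hmem a _).1 ⟨i, i.2, rfl⟩ with hx | hx | hx <;>
      exact h.round.tree.mem_path _ _ hx
  choose L hL using hL
  have hrange : ∀ a, Set.range (L a) = T.bag a₀ a := by
    intro a
    ext x
    have hx : x ∈ Set.range (L a) ↔ ∃ i < 3 * k + 1,
        (E a).getD i ((G.path (N.rev a).1).getLast?.getD 0) = (x : ℕ) + 1 := by
      constructor
      · rintro ⟨i, rfl⟩
        exact ⟨i, i.2, hL a i⟩
      · rintro ⟨i, hi, hix⟩
        refine ⟨⟨i, hi⟩, Fin.ext ?_⟩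
        have := (hL a ⟨i, hi⟩).symm.trans hix
        omega
    rw [hx, hmem, h.last.mem_path, h.last.mem_path, h.last.mem_path]
    rfl
  have hfather : ∀ a : N.Arc, ((N.localInput k a.1).storedBag (G.loc r a.1) a.2).father =
      (T.fatherArc a₀ a).map fun b => (a.2, (b.2 : ℕ)) := by
    intro a
    have h1 : ((N.localInput k a.1).storedBag (G.loc r a.1) a.2).father =
      if (G.loc r a.1).root = true ∧ (a.2 : ℕ) = 0 then none else
        some (a.2, if (G.loc r a.1).exit a.2 = true then
          (((G.loc r a.1).heard a.2).getD (0, 0, [])).1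
          else (((G.loc r a.1).heard a.2).getD (0, 0, [])).2.1) := rfl
    rw [h1, hheard]
    by_cases h2 : a = a₀
    · rw [if_pos ((hroot a).2 h2), h2, T.fatherArc_root]
      rfl
    · rw [if_neg (mt (hroot a).1 h2)]
      by_cases h3 : a ∈ T.closing a₀
      · rw [if_pos ((hexit a).2 h3), T.fatherArc_of_mem_closing h3]
        rfl
      · rw [if_neg (mt (hexit a).1 h3), T.fatherArc_of_notMem_exits fun h4 => h4.elim h2 h3]
        rfl
  have hlabel : ∀ (a : N.Arc) (i : Fin (3 * k + 1)),
      ((N.localInput k a.1).storedBag (G.loc r a.1) a.2).label i = (L a i : ℕ) + 1 := by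
    intro a i
    rw [← hL a i]
    have h1 : ((N.localInput k a.1).storedBag (G.loc r a.1) a.2).label i =
      (((G.loc r a.1).apex a.2).dropLast ++ (G.loc r a.1).path.dropLast ++
        (((G.loc r a.1).heard a.2).getD (0, 0, [])).2.2).getD i
        ((((G.loc r a.1).heard a.2).getD (0, 0, [])).2.2.getLast?.getD 0) := rfl
    rw [h1, hheard, hapex]
    rfl
  rw [h.state]
  refine Network.storesDecomposition_ofFn (T.decompositionTree hT hN a₀) L ?_ h₀
    (fun v => (N.localInput k v).storedBag (G.loc r v)) fun a => ⟨hlabel a, ?_, ?_⟩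
  · rw [IsOrderedTreeDecomposition]
    simp only [hrange]
    exact T.isTreeDecomposition hT hN h₀
  · intro ha
    have ha' : T.fatherArc a₀ a = none := ha
    exact (hfather a).trans (by rw [ha']; rfl)
  · intro b hb
    have hb' : T.fatherArc a₀ a = some b := hb
    refine ⟨a.2, (hfather a).trans (by rw [hb']; rfl), ?_⟩
    -- Either possible father arc has the head of `a` as its tail, so its bag is stored in the
    -- neighbor at the port of `a`.
    have hcases : b = N.rev a ∨ b = N.facePerm a := by
      rw [Network.RootedSubtree.fatherArc] at hb'
      split_ifs at hb'
      · exact Or.inl (Option.some_inj.1 hb').symm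
      · exact Or.inr (Option.some_inj.1 hb').symm
    rcases hcases with rfl | rfl <;> rfl

end Config

/-! ### The constants and the theorem -/

/-- Since n + k + 3 ≤ n · 2^(k + 4), the logarithm exceeds log n by at most k + 4; additive
constants are absorbed because log n ≥ 1. -/
theorem maxBits_le {n k : ℕ} (hn : 2 ≤ n) :
    maxBits n k ≤ (2 * k + 9) * (2 * k + 13) * Nat.log 2 n := by
  have h1 : Nat.log 2 (n + k + 3) ≤ Nat.log 2 n + (k + 4) := by
    have h2 : n + k + 3 ≤ n * 2 ^ (k + 4) := by
      have h3 : k + 4 < 2 ^ (k + 4) := Nat.lt_two_pow_self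
      nlinarith
    have h4 : ∀ m, Nat.log 2 (n * 2 ^ m) = Nat.log 2 n + m := by
      intro m
      induction m with
      | zero => simp
      | succ m ih =>
        rw [pow_succ, ← mul_assoc, Nat.log_mul_base (by norm_num) (by positivity), ih, add_assoc]
    exact (Nat.log_mono_right h2).trans (h4 _).le
  have h2 : 1 ≤ Nat.log 2 n := Nat.log_pos (by norm_num) hn
  rw [maxBits, mul_assoc]
  refine Nat.mul_le_mul_left _ ?_
  nlinarith

theorem mainTheorem4 :
    ∃ A : DistAlgorithm BagList, ∀ k : ℕ, ∃ C : ℕ,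
      ∀ (n : ℕ) (N : Network n) (r : Fin n),
        N.graph.IsBiconnected → N.IsPlanarEmbedding → N.graph.ediam ≤ (k : ℕ∞) →
        (¬ ∃ e : ℕ → Config A N, e 0 = Config.initial A N k r ∧
            ∀ i, Config.Step k (e i) (e (i + 1))) ∧
        ∀ c : Config A N, Config.Reachable k r c →
          c.clock ≤ (C * n : ℝ) ∧
          (∀ a : N.Arc, c.linkCount a ≤ C) ∧
          (∀ p ∈ c.sent, p.body.length ≤ C * Nat.log 2 n) ∧
          (c.transit = 0 →
            StoresDecomposition N k r
              fun v => A.output (N.localInput k v) (c.state v)) := by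
  -- The first summand bounds the time, by 2(k + 1) · 6n, and also the 4(k + 1) messages per link;
  -- the second bounds the message length.
  refine ⟨decompositionAlgorithm, fun k =>
    ⟨(k + 1) * 12 + (2 * k + 9) * (2 * k + 13), fun n N r hG hN hdiam => ?_⟩⟩
  have hn : 3 ≤ n := by simpa using hG.1
  have hk : ∀ v, ∃ w : N.graph.Walk v r, w.length ≤ k := by
    intro v
    obtain ⟨w, hw⟩ := SimpleGraph.Reachable.exists_walk_length_eq_edist (hG.2.1.preconnected v r)
    refine ⟨w, ?_⟩
    have h := SimpleGraph.edist_le_ediam.trans hdiam (a := N.graph.edist v r)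
    rw [← hw] at h
    exact_mod_cast h
  obtain ⟨u, hur, hu⟩ := Network.exists_ne_neighbor hG r r
  -- The requesting node has a neighbor different from itself, so the diameter is not 0.
  have hk0 : k ≠ 0 := by
    rintro rfl
    obtain ⟨w, hw⟩ := hk u
    exact hur (SimpleGraph.Walk.eq_of_length_eq_zero (Nat.le_zero.1 hw))
  have hdeg : 0 < N.deg r := (Nat.zero_le _).trans_lt ((N.port r).symm ⟨u, hu⟩).2
  set a₀ : N.Arc := ⟨r, 0, hdeg⟩
  refine ⟨Config.not_exists_infinite (a₀ := a₀) hN hk hk0 rfl rfl, fun c hc => ?_⟩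
  obtain ⟨m, hm⟩ := Config.exists_tracked_of_reachable (a₀ := a₀) hN hk hk0 rfl rfl hc
  refine ⟨?_, ?_, ?_, ?_⟩
  · have h1 : m ≤ ((k + 1) * 12 + (2 * k + 9) * (2 * k + 13)) * n := by
      calc m ≤ (k + 1) * (2 * Nat.card N.Arc) := hm.stage.le
        _ ≤ (k + 1) * (2 * (6 * n)) := by
          gcongr
          exact Network.card_arc_le hG hN
        _ = (k + 1) * 12 * n := by ring
        _ ≤ _ := Nat.mul_le_mul_right n (Nat.le_add_right _ _)
    exact hm.clock_le.trans (by exact_mod_cast h1)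
  · exact fun a => (hm.stage.linkCount_le a).trans (by omega)
  · intro p hp
    refine ((hm.length_le p hp).trans (maxBits_le (by omega))).trans ?_
    exact Nat.mul_le_mul_right _ (Nat.le_add_left _ _)
  · intro ht
    cases hm.stage with
    | onWay h =>
      rw [h.transit] at ht
      exact absurd ht (Multiset.singleton_ne_zero _)
    | answered h =>
      obtain ⟨_, _, -, htr, -⟩ := h.state
      rw [htr] at ht
      exact absurd ht (Multiset.singleton_ne_zero _)
    | halted h => exact h.storesDecomposition hN rfl rfl
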